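/- **Theorem (Coherent Newman's lemma modulo).** Let $n\ge 1$ and let $(R,E,S)$ be an $n$-polygraph modulo. That is: $R$ is an $n$-polygraph; $E$ is an $n$-polygraph with $E_{\le n-2}=R_{\le n-2}$ and $E_{n-1}\subseteq R_{n-1}$; and $S$ is a cellular extension of the free $(n-1)$-category $R_{n-1}^\ast$ with $R_n\subseteq S\subseteq {}_ER_E$. Here $E^\top$ denotes the free $(n,n-1)$-category generated over $R_{n-1}^\ast$ by the $n$-cells of $E$, and ${}_ER_E$ is the cellular extension of $R_{n-1}^\ast$ whose elements are the composable triples $(e,f,e')$, with $e,e'$ $n$-cells of $E^\top$ and $f$ an $n$-cell of $R^\ast$ containing exactly one generating $n$-cell, from the source of $e$ to the target of $e'$; a rule $r\in R_n$ is identified with $(1,r,1)$. Let $S^\ast$ be the free $n$-category generated by $S$ over $R_{n-1}^\ast$, and $R^\ast(E)$ the free $n$-category generated over $R_{n-1}^\ast$ by $R_n$ and by invertible $n$-cells for $E_n$. The length $\ell$ of an $n$-cell of $S^\ast$ is the number of generators it contains; the length $\ell$ of an $n$-cell of $E^\top$ is the least number of generators and inverses of generators in an expression for it. Let $\Gamma$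 be a square extension of $(E^\top,S^\ast)$: a set of squares, each with a top $f$ and a bottom $g$ in $S^\ast$ and a left side $e$ and a right side $e'$ in $E^\top$, with matching corners. Let $E\rtimes\Gamma$ be the set of the squares with top $e_1f$, bottom $e_2^-g$, left side $e_1ee_2$ and right side $e'$, for all squares of $\Gamma$ with top $f$, bottom $g$, left side $e$, right side $e'$, and all $e_1,e_2$ in $E^\top$ for which $e_1ee_2$ is defined and the cells $e_1f$ and $e_2^-g$ of $R^\ast(E)$ are cells of $S^\ast$ (that is, images of cells of $S^\ast$ under the canonical functor $S^\ast\to R^\ast(E)$, any such cells being admitted as top and bottom). The Peiffer squares are, for $f:u\to u'$ in $S^\ast$, $e:v\to v'$ in $E^\top$ and $0\le i\le n-2$, the squares with top $f\star_i v$, bottom $f\star_i v'$, left side $u\star_i e$, right side $u'\star_i e$, and those with top $v\star_i f$, bottom $v'\star_i f$, left side $e\star_i u$, right side $e\star_i u'$, whenever these are defined. Let $\mathcal D$ be the free $(n-1)$-category enriched in double categories, whose vertical $n$-cells are those of $E^\top$, whose horizontal $n$-cells are those of $S^\ast$, whose square cells are generated by $E\rtimes\Gamma$ and the Peiffer squares,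 and in which every square cell is invertible for the composition that stacks squares along their horizontal sides. A branching modulo $E$ is a triple $(f,e,g)$ with $f,g$ in $S^\ast$, $f$ not an identity, and $e$ in $E^\top$ from the source of $f$ to the source of $g$. It is local if $\ell(f)=1$ and $\ell(g)+\ell(e)=1$. It is $\Gamma$-confluent modulo $E$ if there are $n$-cells $f',g'$ of $S^\ast$, an $n$-cell $e'$ of $E^\top$ and a square cell of $\mathcal D$ with top $f\star_{n-1}f'$, bottom $g\star_{n-1}g'$, left side $e$ and right side $e'$. Suppose that ${}_ER_E$ is terminating, that is, there is no infinite sequence of rewriting steps ($n$-cells of length one) of the free $n$-category on ${}_ER_E$. If every local branching modulo $E$ is $\Gamma$-confluent modulo $E$ (that is, $S$ is locally $\Gamma$-confluent modulo $E$), then every branching modulo $E$ is $\Gamma$-confluent modulo $E$ (that is, $S$ is $\Gamma$-confluent modulo $E$). -/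

import Mathlib

universe u

namespace Polygr

/-- A (small, strict, globular) `n`-category, in its one-set presentation.
`Cell` is the set of `n`-cells; a `k`-cell (`k ≤ n`) is identified with the identity `n`-cell on
it, so that the `k`-cells are the `x` with `s k x = x`. `s i x` and `t i x` are the `i`-source and
the `i`-target of `x`, and are `x` itself for `i ≥ n`. `comp i x y` is the `i`-composite
`x ⋆_i y`; it has a meaning only if `t i x = s i y`. -/
structure NCat (n : ℕ) where
  Cell : Type u
  s : ℕ → Cell → Cell
  t : ℕ → Cell → Cell
  comp : ℕ → Cell → Cell → Cell
  s_top : ∀ {i x}, n ≤ i → s i x = x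
  t_top : ∀ {i x}, n ≤ i → t i x = x
  s_s : ∀ {i j x}, i ≤ j → s i (s j x) = s i x
  s_t : ∀ {i j x}, i < j → s i (t j x) = s i x
  t_s : ∀ {i j x}, i < j → t i (s j x) = t i x
  t_t : ∀ {i j x}, i ≤ j → t i (t j x) = t i x
  s_s' : ∀ {i j x}, i ≤ j → s j (s i x) = s i x
  t_s' : ∀ {i j x}, i ≤ j → t j (s i x) = s i x
  s_t' : ∀ {i j x}, i ≤ j → s j (t i x) = t i x
  t_t' : ∀ {i j x}, i ≤ j → t j (t i x) = t i x
  s_comp : ∀ {i a b}, t i a = s i b → s i (comp i a b) = s i a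
  t_comp : ∀ {i a b}, t i a = s i b → t i (comp i a b) = t i b
  s_comp_lt : ∀ {i j a b}, i < j → t i a = s i b → s j (comp i a b) = comp i (s j a) (s j b)
  t_comp_lt : ∀ {i j a b}, i < j → t i a = s i b → t j (comp i a b) = comp i (t j a) (t j b)
  id_comp : ∀ {i a}, comp i (s i a) a = a
  comp_id : ∀ {i a}, comp i a (t i a) = a
  assoc : ∀ {i a b c}, t i a = s i b → t i b = s i c →
    comp i (comp i a b) c = comp i a (comp i b c)
  exchange : ∀ {i j a b c d}, i < j → t j a = s j b → t j c = s j d → t i a = s i c →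
    comp i (comp j a b) (comp j c d) = comp j (comp i a c) (comp i b d)

/-- A set, seen as a `0`-category. -/
def NCat.disc (X : Type u) : NCat.{u} 0 where
  Cell := X
  s _ x := x
  t _ x := x
  comp _ x _ := x
  s_top _ := rfl
  t_top _ := rfl
  s_s _ := rfl
  s_t _ := rfl
  t_s _ := rfl
  t_t _ := rfl
  s_s' _ := rfl
  t_s' _ := rfl
  s_t' _ := rfl
  t_t' _ := rfl
  s_comp _ := rfl
  t_comp h := h
  s_comp_lt _ _ := rfl
  t_comp_lt _ _ := rfl
  id_comp := rfl
  comp_id := rfl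
  assoc _ _ := rfl
  exchange _ _ _ _ := rfl

/-- An `n`-functor. -/
structure NFunctor {n : ℕ} (C D : NCat.{u} n) where
  map : C.Cell → D.Cell
  map_s : ∀ i x, map (C.s i x) = D.s i (map x)
  map_t : ∀ i x, map (C.t i x) = D.t i (map x)
  map_comp : ∀ i x y, C.t i x = C.s i y → map (C.comp i x y) = D.comp i (map x) (map y)

namespace NCat

variable {n : ℕ} (B : NCat.{u} n)

theorem s_comp_gt {i j : ℕ} {a b : B.Cell} (hji : j < i) (h : B.t i a = B.s i b) :
    B.s j (B.comp i a b) = B.s j a := by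
  rw [← B.s_s hji.le, B.s_comp h, B.s_s hji.le]

theorem t_comp_gt {i j : ℕ} {a b : B.Cell} (hji : j < i) (h : B.t i a = B.s i b) :
    B.t j (B.comp i a b) = B.t j b := by
  rw [← B.t_t hji.le, B.t_comp h, B.t_t hji.le]

end NCat

/-- An `(m+1)`-category whose underlying `m`-category is `B`: a set of `(m+1)`-cells with source and
target `m`-cells in `B`, identities on the `m`-cells of `B`, and compositions `⋆_i` for `i ≤ m`.
`comp i a b` has a meaning only if the `i`-target of `a`, that is `B.t i (tgt a)`, is the
`i`-source of `b`, that is `B.s i (src b)`. -/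
structure ExtCat {m : ℕ} (B : NCat.{u} m) where
  Cell : Type u
  src : Cell → B.Cell
  tgt : Cell → B.Cell
  one : B.Cell → Cell
  comp : ℕ → Cell → Cell → Cell
  s_src : ∀ {i a}, i < m → B.s i (src a) = B.s i (tgt a)
  t_src : ∀ {i a}, i < m → B.t i (src a) = B.t i (tgt a)
  src_one : ∀ {x}, src (one x) = x
  tgt_one : ∀ {x}, tgt (one x) = x
  src_comp : ∀ {a b}, tgt a = src b → src (comp m a b) = src a
  tgt_comp : ∀ {a b}, tgt a = src b → tgt (comp m a b) = tgt b
  src_comp_lt : ∀ {i a b}, i < m → B.t i (tgt a) = B.s i (src b) →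
    src (comp i a b) = B.comp i (src a) (src b)
  tgt_comp_lt : ∀ {i a b}, i < m → B.t i (tgt a) = B.s i (src b) →
    tgt (comp i a b) = B.comp i (tgt a) (tgt b)
  one_comp : ∀ {i x y}, i < m → B.t i x = B.s i y →
    one (B.comp i x y) = comp i (one x) (one y)
  id_comp : ∀ {i a}, i ≤ m → comp i (one (B.s i (src a))) a = a
  comp_id : ∀ {i a}, i ≤ m → comp i a (one (B.t i (tgt a))) = a
  assoc : ∀ {i a b c}, i ≤ m → B.t i (tgt a) = B.s i (src b) → B.t i (tgt b) = B.s i (src c) →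
    comp i (comp i a b) c = comp i a (comp i b c)
  exchange : ∀ {i j a b c d}, i < j → j ≤ m → B.t j (tgt a) = B.s j (src b) →
    B.t j (tgt c) = B.s j (src d) → B.t i (tgt a) = B.s i (src c) →
    comp i (comp j a b) (comp j c d) = comp j (comp i a c) (comp i b d)

namespace ExtCat

variable {m : ℕ} {B : NCat.{u} m} (D : ExtCat B)

theorem s_src' {i : ℕ} {a : D.Cell} (h : i < m) : B.s i (D.tgt a) = B.s i (D.src a) :=
  (D.s_src h).symm

theorem t_tgt {i : ℕ} {a : D.Cell} (h : i < m) : B.t i (D.tgt a) = B.t i (D.src a) :=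
  (D.t_src h).symm

theorem comp_top {a b : D.Cell} (h : B.t m (D.tgt a) = B.s m (D.src b)) : D.tgt a = D.src b := by
  rwa [B.t_top le_rfl, B.s_top le_rfl] at h

theorem src_comp_le {i : ℕ} {a b : D.Cell} (hi : i ≤ m) (h : B.t i (D.tgt a) = B.s i (D.src b)) :
    B.s i (D.src (D.comp i a b)) = B.s i (D.src a) := by
  rcases hi.lt_or_eq with hi | rfl
  · rw [D.src_comp_lt hi h, B.s_comp (by rw [D.t_src hi, h])]
  · rw [D.src_comp (D.comp_top h)]

theorem tgt_comp_le {i : ℕ} {a b : D.Cell} (hi : i ≤ m) (h : B.t i (D.tgt a) = B.s i (D.src b)) :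
    B.t i (D.tgt (D.comp i a b)) = B.t i (D.tgt b) := by
  rcases hi.lt_or_eq with hi | rfl
  · rw [D.tgt_comp_lt hi h, B.t_comp (by rw [h, D.s_src hi])]
  · rw [D.tgt_comp (D.comp_top h)]

/-- The `(m+1)`-category given by `D` and its underlying `m`-category `B`. -/
def toNCat : NCat.{u} (m + 1) where
  Cell := D.Cell
  s i a := if i ≤ m then D.one (B.s i (D.src a)) else a
  t i a := if i ≤ m then D.one (B.t i (D.tgt a)) else a
  comp i a b := if i ≤ m then D.comp i a b else a
  s_top h := if_neg (by omega)
  t_top h := if_neg (by omega)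
  s_s {i j x} h := by
    by_cases hj : j ≤ m
    · simp [hj, h.trans hj, D.src_one, B.s_s h]
    · simp [hj]
  s_t {i j x} h := by
    by_cases hj : j ≤ m
    · have hi : i < m := by omega
      simp [hj, hi.le, D.src_one, B.s_t h, D.s_src hi]
    · simp [hj]
  t_s {i j x} h := by
    by_cases hj : j ≤ m
    · have hi : i < m := by omega
      simp [hj, hi.le, D.tgt_one, B.t_s h, D.t_src hi]
    · simp [hj]
  t_t {i j x} h := by
    by_cases hj : j ≤ m
    · simp [hj, h.trans hj, D.tgt_one, B.t_t h]
    · simp [hj]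
  s_s' {i j x} h := by
    by_cases hj : j ≤ m
    · simp [hj, h.trans hj, D.src_one, B.s_s' h]
    · simp [hj]
  t_s' {i j x} h := by
    by_cases hj : j ≤ m
    · simp [hj, h.trans hj, D.tgt_one, B.t_s' h]
    · simp [hj]
  s_t' {i j x} h := by
    by_cases hj : j ≤ m
    · simp [hj, h.trans hj, D.src_one, B.s_t' h]
    · simp [hj]
  t_t' {i j x} h := by
    by_cases hj : j ≤ m
    · simp [hj, h.trans hj, D.tgt_one, B.t_t' h]
    · simp [hj]
  s_comp {i a b} h := by
    by_cases hi : i ≤ m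
    · simp only [hi, if_true] at h ⊢
      have h' := congrArg D.src h
      rw [D.src_one, D.src_one] at h'
      rw [D.src_comp_le hi h']
    · simp [hi]
  t_comp {i a b} h := by
    by_cases hi : i ≤ m
    · simp only [hi, if_true] at h ⊢
      have h' := congrArg D.src h
      rw [D.src_one, D.src_one] at h'
      rw [D.tgt_comp_le hi h']
    · simpa [hi] using h
  s_comp_lt {i j a b} hij h := by
    by_cases hj : j ≤ m
    · have hi : i < m := by omega
      simp only [hi.le, hj, if_true] at h ⊢
      have h' := congrArg D.src h
      rw [D.src_one, D.src_one] at h'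
      have h2 : B.t i (D.src a) = B.s i (D.src b) := by rw [D.t_src hi, h']
      rw [D.src_comp_lt hi h', B.s_comp_lt hij h2, D.one_comp hi (by rw [B.t_s hij, B.s_s hij.le, h2])]
    · simp [hj]
  t_comp_lt {i j a b} hij h := by
    by_cases hj : j ≤ m
    · have hi : i < m := by omega
      simp only [hi.le, hj, if_true] at h ⊢
      have h' := congrArg D.src h
      rw [D.src_one, D.src_one] at h'
      have h2 : B.t i (D.tgt a) = B.s i (D.tgt b) := by rw [← D.s_src hi, h']
      rw [D.tgt_comp_lt hi h', B.t_comp_lt hij h2, D.one_comp hi (by rw [B.t_t hij.le, B.s_t hij, h2])]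
    · simp [hj]
  id_comp {i a} := by
    by_cases hi : i ≤ m
    · simp [hi, D.id_comp hi]
    · simp [hi]
  comp_id {i a} := by
    by_cases hi : i ≤ m
    · simp [hi, D.comp_id hi]
    · simp [hi]
  assoc {i a b c} h₁ h₂ := by
    by_cases hi : i ≤ m
    · simp only [hi, if_true] at h₁ h₂ ⊢
      have h₁' := congrArg D.src h₁
      have h₂' := congrArg D.src h₂
      rw [D.src_one, D.src_one] at h₁' h₂'
      exact D.assoc hi h₁' h₂'
    · simp [hi]
  exchange {i j a b c d} hij h₁ h₂ h₃ := by
    by_cases hj : j ≤ m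
    · have hi : i < m := by omega
      simp only [hi.le, hj, if_true] at h₁ h₂ h₃ ⊢
      have h₁' := congrArg D.src h₁
      have h₂' := congrArg D.src h₂
      have h₃' := congrArg D.src h₃
      rw [D.src_one, D.src_one] at h₁' h₂' h₃'
      exact D.exchange hij hj h₁' h₂' h₃'
    · simp [hj]

/-- `b` is the inverse of the `(m+1)`-cell `a`. -/
def IsInverse (a b : D.Cell) : Prop :=
  D.src b = D.tgt a ∧ D.tgt b = D.src a ∧
    D.comp m a b = D.one (D.src a) ∧ D.comp m b a = D.one (D.tgt a)

/-- A functor of `(m+1)`-categories that is the identity on the common underlying `m`-category. -/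
structure Hom (D D' : ExtCat B) where
  map : D.Cell → D'.Cell
  src_map : ∀ a, D'.src (map a) = D.src a
  tgt_map : ∀ a, D'.tgt (map a) = D.tgt a
  map_one : ∀ x, map (D.one x) = D'.one x
  map_comp : ∀ i a b, i ≤ m → B.t i (D.tgt a) = B.s i (D.src b) →
    map (D.comp i a b) = D'.comp i (map a) (map b)

/-- The induced functor between the whole `(m+1)`-categories. -/
def Hom.toNFunctor {D D' : ExtCat B} (F : Hom D D') : NFunctor D.toNCat D'.toNCat where
  map := F.map
  map_s i (x : D.Cell) := by
    change F.map (if i ≤ m then _ else x) = if i ≤ m then _ else F.map x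
    by_cases hi : i ≤ m
    · rw [if_pos hi, if_pos hi, F.map_one, F.src_map x]
    · rw [if_neg hi, if_neg hi]
  map_t i (x : D.Cell) := by
    change F.map (if i ≤ m then _ else x) = if i ≤ m then _ else F.map x
    by_cases hi : i ≤ m
    · rw [if_pos hi, if_pos hi, F.map_one, F.tgt_map x]
    · rw [if_neg hi, if_neg hi]
  map_comp i (x y : D.Cell) h := by
    change (if i ≤ m then D.one (B.t i (D.tgt x)) else x) =
      (if i ≤ m then D.one (B.s i (D.src y)) else y) at h
    change F.map (if i ≤ m then _ else x) = if i ≤ m then _ else F.map x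
    by_cases hi : i ≤ m
    · rw [if_pos hi, if_pos hi] at h ⊢
      have h' := congrArg D.src h
      rw [D.src_one, D.src_one] at h'
      exact F.map_comp i x y hi h'
    · rw [if_neg hi, if_neg hi]

end ExtCat

/-- A cellular extension of an `m`-category `B`: a set `Gen` with a map to the `m`-spheres of `B`,
that is to the pairs of parallel `m`-cells. -/
structure CellExt {m : ℕ} (B : NCat.{u} m) where
  Gen : Type u
  src : Gen → B.Cell
  tgt : Gen → B.Cell
  s_src : ∀ {i γ}, i < m → B.s i (src γ) = B.s i (tgt γ)
  t_src : ∀ {i γ}, i < m → B.t i (src γ) = B.t i (tgt γ)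

namespace CellExt

variable {m : ℕ} {B : NCat.{u} m}

/-- Formal composites of elements of `Γ` and of identities on `m`-cells of `B`. -/
inductive Raw (Γ : CellExt B) : Type u
  | gen (γ : Γ.Gen) : Raw Γ
  | one (x : B.Cell) : Raw Γ
  | comp (i : ℕ) (a b : Raw Γ) : Raw Γ

namespace Raw

variable {Γ : CellExt B}

/-- The source `m`-cell of a formal composite. -/
def src : Raw Γ → B.Cell
  | gen γ => Γ.src γ
  | one x => x
  | comp i a b => if i < m then B.comp i a.src b.src else a.src

/-- The target `m`-cell of a formal composite. -/
def tgt : Raw Γ → B.Cell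
  | gen γ => Γ.tgt γ
  | one x => x
  | comp i a b => if i < m then B.comp i a.tgt b.tgt else b.tgt

/-- All the compositions in the formal composite are composites `a ⋆_i b` with `i ≤ m` such that
the `i`-target of `a` is the `i`-source of `b`. -/
def WF : Raw Γ → Prop
  | gen _ => True
  | one _ => True
  | comp i a b => a.WF ∧ b.WF ∧ i ≤ m ∧ B.t i a.tgt = B.s i b.src

/-- The number of occurrences of elements of `Γ` in a formal composite. -/
def count : Raw Γ → ℕ
  | gen _ => 1
  | one _ => 0
  | comp _ a b => a.count + b.count

end Raw

/-- The axioms of `(m+1)`-categories, as pairs of formal composites. -/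
inductive Ax (Γ : CellExt B) : Raw Γ → Raw Γ → Prop
  | assoc (i : ℕ) (a b c : Raw Γ) : Ax Γ (.comp i (.comp i a b) c) (.comp i a (.comp i b c))
  | id_comp (i : ℕ) (a : Raw Γ) : Ax Γ (.comp i (.one (B.s i a.src)) a) a
  | comp_id (i : ℕ) (a : Raw Γ) : Ax Γ (.comp i a (.one (B.t i a.tgt))) a
  | one_comp (i : ℕ) (x y : B.Cell) (h : i < m) :
      Ax Γ (.one (B.comp i x y)) (.comp i (.one x) (.one y))
  | exchange (i j : ℕ) (a b c d : Raw Γ) (h : i < j) :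
      Ax Γ (.comp i (.comp j a b) (.comp j c d)) (.comp j (.comp i a c) (.comp i b d))

/-- The congruence on formal composites generated by the axioms of `(m+1)`-categories and by the
pairs of parallel composites in `X`. -/
inductive Rel (Γ : CellExt B) (X : Raw Γ → Raw Γ → Prop) : Raw Γ → Raw Γ → Prop
  | refl (a : Raw Γ) : Rel Γ X a a
  | symm {a b : Raw Γ} : Rel Γ X a b → Rel Γ X b a
  | trans {a b c : Raw Γ} : Rel Γ X a b → Rel Γ X b c → Rel Γ X a c
  | congr (i : ℕ) {a a' b b' : Raw Γ} :
      Rel Γ X a a' → Rel Γ X b b' → Rel Γ X (.comp i a b) (.comp i a' b')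
  | ax {a b : Raw Γ} : Ax Γ a b → a.WF → b.WF → Rel Γ X a b
  | rel {a b : Raw Γ} : X a b → a.WF → b.WF → a.src = b.src → a.tgt = b.tgt → Rel Γ X a b

section

variable {Γ : CellExt B} {X : Raw Γ → Raw Γ → Prop}

theorem Raw.WF.parallel : ∀ {a : Raw Γ}, a.WF → ∀ {i : ℕ}, i < m →
    B.s i a.src = B.s i a.tgt ∧ B.t i a.src = B.t i a.tgt
  | .gen γ, _, i, hi => ⟨Γ.s_src hi, Γ.t_src hi⟩
  | .one x, _, i, hi => ⟨rfl, rfl⟩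
  | .comp j a b, ⟨ha, hb, hj, h⟩, i, hi => by
    have pa : ∀ {i : ℕ}, i < m → _ := fun {i} => Raw.WF.parallel ha (i := i)
    have pb : ∀ {i : ℕ}, i < m → _ := fun {i} => Raw.WF.parallel hb (i := i)
    by_cases hjm : j < m
    · simp only [Raw.src, Raw.tgt, hjm, if_true]
      have h1 : B.t j a.src = B.s j b.src := by rw [(pa hjm).2, h]
      have h2 : B.t j a.tgt = B.s j b.tgt := by rw [← (pb hjm).1, h]
      rcases lt_trichotomy i j with hij | rfl | hij
      · rw [B.s_comp_gt hij h1, B.s_comp_gt hij h2, B.t_comp_gt hij h1, B.t_comp_gt hij h2]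
        exact ⟨(pa hi).1, (pb hi).2⟩
      · rw [B.s_comp h1, B.s_comp h2, B.t_comp h1, B.t_comp h2]
        exact ⟨(pa hi).1, (pb hi).2⟩
      · rw [B.s_comp_lt hij h1, B.s_comp_lt hij h2, B.t_comp_lt hij h1, B.t_comp_lt hij h2,
          (pa hi).1, (pb hi).1, (pa hi).2, (pb hi).2]
        exact ⟨rfl, rfl⟩
    · have hjm' : j = m := by omega
      subst hjm'
      simp only [Raw.src, Raw.tgt, lt_irrefl, if_false]
      rw [B.t_top le_rfl, B.s_top le_rfl] at h
      constructor
      · rw [(pa hi).1, h, (pb hi).1]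
      · rw [(pa hi).2, h, (pb hi).2]

theorem Ax.boundary {a b : Raw Γ} (h : Ax Γ a b) (ha : a.WF) (hb : b.WF) :
    a.src = b.src ∧ a.tgt = b.tgt := by
  induction h with
  | assoc i a b c =>
    obtain ⟨⟨wa, wb, hi, h1⟩, wc, -, h2⟩ := ha
    obtain ⟨-, ⟨-, -, -, h3⟩, -, h4⟩ := hb
    by_cases him : i < m
    · simp only [Raw.src, Raw.tgt, him, if_true]
      refine ⟨B.assoc (by rw [(wa.parallel him).2, h1]) (by rw [(wb.parallel him).2, h3]),
        B.assoc (by rw [h1, (wb.parallel him).1]) (by rw [h3, (wc.parallel him).1])⟩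
    · simp [Raw.src, Raw.tgt, him]
  | id_comp i a =>
    obtain ⟨-, wa, hi, h1⟩ := ha
    by_cases him : i < m
    · simp only [Raw.src, Raw.tgt, him, if_true]
      refine ⟨B.id_comp, ?_⟩
      rw [(wa.parallel him).1, B.id_comp]
    · have : i = m := by omega
      subst this
      simp [Raw.src, Raw.tgt, B.s_top le_rfl]
  | comp_id i a =>
    obtain ⟨wa, -, hi, h1⟩ := ha
    by_cases him : i < m
    · simp only [Raw.src, Raw.tgt, him, if_true]
      refine ⟨?_, B.comp_id⟩
      rw [← (wa.parallel him).2, B.comp_id]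
    · have : i = m := by omega
      subst this
      simp [Raw.src, Raw.tgt, B.t_top le_rfl]
  | one_comp i x y h => simp [Raw.src, Raw.tgt, h]
  | exchange i j a b c d hij =>
    obtain ⟨⟨wa, wb, hj, h1⟩, ⟨wc, wd, -, h2⟩, hi, h3⟩ := ha
    obtain ⟨⟨-, -, -, h4⟩, ⟨-, -, -, h5⟩, -, h6⟩ := hb
    have him : i < m := by omega
    by_cases hjm : j < m
    · simp only [Raw.src, Raw.tgt, him, hjm, if_true]
      refine ⟨B.exchange hij ?_ ?_ ?_, B.exchange hij ?_ ?_ ?_⟩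
      · rw [(wa.parallel hjm).2, h1]
      · rw [(wc.parallel hjm).2, h2]
      · rw [(wa.parallel him).2, h4]
      · rw [h1, (wb.parallel hjm).1]
      · rw [h2, (wd.parallel hjm).1]
      · rw [h4, (wc.parallel him).1]
    · simp [Raw.src, Raw.tgt, him, hjm]

theorem Rel.boundary {a b : Raw Γ} (h : Rel Γ X a b) : a.src = b.src ∧ a.tgt = b.tgt := by
  induction h with
  | refl a => exact ⟨rfl, rfl⟩
  | symm _ ih => exact ⟨ih.1.symm, ih.2.symm⟩
  | trans _ _ ih₁ ih₂ => exact ⟨ih₁.1.trans ih₂.1, ih₁.2.trans ih₂.2⟩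
  | congr i _ _ ih₁ ih₂ => simp only [Raw.src, Raw.tgt, ih₁.1, ih₁.2, ih₂.1, ih₂.2, and_self]
  | ax h ha hb => exact h.boundary ha hb
  | rel _ _ _ h₁ h₂ => exact ⟨h₁, h₂⟩

variable (Γ X)

/-- Well-formed formal composites, up to the congruence `Rel Γ X`. -/
def relSetoid : Setoid {a : Raw Γ // a.WF} where
  r a b := Rel Γ X a.1 b.1
  iseqv := ⟨fun _ => .refl _, .symm, .trans⟩

/-- The `(m+1)`-cells presented by the generators `Γ` and the relations `X`. -/
def Cells : Type u := Quotient (relSetoid Γ X)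

variable {Γ}

/-- The cell represented by a well-formed formal composite. -/
def cls (a : Raw Γ) (h : a.WF) : Cells Γ X := Quotient.mk (relSetoid Γ X) ⟨a, h⟩

variable {X}

theorem cls_eq {a b : Raw Γ} {ha : a.WF} {hb : b.WF} (h : Rel Γ X a b) : cls X a ha = cls X b hb :=
  Quotient.sound (s := relSetoid Γ X) h

theorem cls_exact {a b : Raw Γ} {ha : a.WF} {hb : b.WF} (h : cls X a ha = cls X b hb) :
    Rel Γ X a b :=
  Quotient.exact (s := relSetoid Γ X) h

theorem Cells.ind {p : Cells Γ X → Prop} (h : ∀ a ha, p (cls X a ha)) (x : Cells Γ X) : p x :=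
  Quotient.ind (s := relSetoid Γ X) (fun a => h a.1 a.2) x

/-- The source of a cell. -/
def Cells.src (x : Cells Γ X) : B.Cell :=
  Quotient.lift (s := relSetoid Γ X) (fun a => a.1.src) (fun _ _ h => (Rel.boundary h).1) x

/-- The target of a cell. -/
def Cells.tgt (x : Cells Γ X) : B.Cell :=
  Quotient.lift (s := relSetoid Γ X) (fun a => a.1.tgt) (fun _ _ h => (Rel.boundary h).2) x

/-- A formal composite that represents the cell. -/
noncomputable def Cells.rep (x : Cells Γ X) : {a : Raw Γ // a.WF} :=
  Quotient.out (s := relSetoid Γ X) x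

theorem cls_rep (x : Cells Γ X) : cls X x.rep.1 x.rep.2 = x := Quotient.out_eq (s := relSetoid Γ X) x

theorem rep_cls (a : Raw Γ) (ha : a.WF) : Rel Γ X (cls X a ha).rep.1 a :=
  cls_exact (ha := (cls X a ha).rep.2) (hb := ha) (cls_rep _)

theorem src_rep (x : Cells Γ X) : x.rep.1.src = x.src := congrArg Cells.src (cls_rep x)

theorem tgt_rep (x : Cells Γ X) : x.rep.1.tgt = x.tgt := congrArg Cells.tgt (cls_rep x)

open Classical in
/-- The composite `x ⋆_i y` of composable cells (and `x` if they are not composable). -/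
noncomputable def Cells.comp (i : ℕ) (x y : Cells Γ X) : Cells Γ X :=
  if h : (Raw.comp i x.rep.1 y.rep.1).WF then cls X _ h else x

theorem comp_cls (i : ℕ) {a b : Raw Γ} (ha : a.WF) (hb : b.WF) (h : (Raw.comp i a b).WF) :
    Cells.comp i (cls X a ha) (cls X b hb) = cls X (.comp i a b) h := by
  have h' : (Raw.comp i (cls X a ha).rep.1 (cls X b hb).rep.1).WF := by
    refine ⟨(cls X a ha).rep.2, (cls X b hb).rep.2, h.2.2.1, ?_⟩
    rw [(rep_cls a ha).boundary.2, (rep_cls b hb).boundary.1]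
    exact h.2.2.2
  rw [Cells.comp, dif_pos h']
  exact cls_eq (.congr i (rep_cls a ha) (rep_cls b hb))

end

/-- The `(m+1)`-category with underlying `m`-category `B` presented by the generating
`(m+1)`-cells `Γ` and the relations `X`: all formal composites of elements of `Γ` and identities,
up to the axioms of `(m+1)`-categories and the congruence generated by `X`. -/
noncomputable def present (Γ : CellExt B) (X : Raw Γ → Raw Γ → Prop) : ExtCat B where
  Cell := Cells Γ X
  src := Cells.src
  tgt := Cells.tgt
  one x := cls X (.one x) trivial
  comp := Cells.comp
  s_src {i a} h := Cells.ind (p := fun a => B.s i a.src = B.s i a.tgt) (fun _ ha => (ha.parallel h).1) a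
  t_src {i a} h := Cells.ind (p := fun a => B.t i a.src = B.t i a.tgt) (fun _ ha => (ha.parallel h).2) a
  src_one := rfl
  tgt_one := rfl
  src_comp {x y} := by
    induction x using Cells.ind with | _ a ha
    induction y using Cells.ind with | _ b hb
    intro h
    rw [comp_cls m ha hb ⟨ha, hb, le_rfl, by rw [B.t_top le_rfl, B.s_top le_rfl]; exact h⟩]
    change (if m < m then _ else _) = _
    rw [if_neg (lt_irrefl m)]
    rfl
  tgt_comp {x y} := by
    induction x using Cells.ind with | _ a ha
    induction y using Cells.ind with | _ b hb
    intro h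
    rw [comp_cls m ha hb ⟨ha, hb, le_rfl, by rw [B.t_top le_rfl, B.s_top le_rfl]; exact h⟩]
    change (if m < m then _ else _) = _
    rw [if_neg (lt_irrefl m)]
    rfl
  src_comp_lt {i x y} hi := by
    induction x using Cells.ind with | _ a ha
    induction y using Cells.ind with | _ b hb
    intro h
    rw [comp_cls i ha hb ⟨ha, hb, hi.le, h⟩]
    change (if i < m then _ else _) = _
    rw [if_pos hi]
    rfl
  tgt_comp_lt {i x y} hi := by
    induction x using Cells.ind with | _ a ha
    induction y using Cells.ind with | _ b hb
    intro h
    rw [comp_cls i ha hb ⟨ha, hb, hi.le, h⟩]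
    change (if i < m then _ else _) = _
    rw [if_pos hi]
    rfl
  one_comp {i x y} hi h := by
    have w : (Raw.comp i (.one x : Raw Γ) (.one y)).WF := ⟨trivial, trivial, hi.le, h⟩
    rw [comp_cls (a := .one x) (b := .one y) i trivial trivial w]
    exact cls_eq (.ax (.one_comp i x y hi) trivial w)
  id_comp {i x} hi := by
    induction x using Cells.ind with | _ a ha
    have w : (Raw.comp i (.one (B.s i a.src)) a).WF := ⟨trivial, ha, hi, B.t_s' le_rfl⟩
    change Cells.comp i (cls X (.one (B.s i a.src)) trivial) _ = _
    rw [comp_cls (a := .one (B.s i a.src)) i trivial ha w]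
    exact cls_eq (.ax (.id_comp i a) w ha)
  comp_id {i x} hi := by
    induction x using Cells.ind with | _ a ha
    have w : (Raw.comp i a (.one (B.t i a.tgt))).WF := ⟨ha, trivial, hi, (B.s_t' le_rfl).symm⟩
    change Cells.comp i _ (cls X (.one (B.t i a.tgt)) trivial) = _
    rw [comp_cls (b := .one (B.t i a.tgt)) i ha trivial w]
    exact cls_eq (.ax (.comp_id i a) w ha)
  assoc {i x y z} hi := by
    induction x using Cells.ind with | _ a ha
    induction y using Cells.ind with | _ b hb
    induction z using Cells.ind with | _ c hc
    intro h₁ h₂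
    change B.t i a.tgt = B.s i b.src at h₁
    change B.t i b.tgt = B.s i c.src at h₂
    have w₁ : (Raw.comp i a b).WF := ⟨ha, hb, hi, h₁⟩
    have w₂ : (Raw.comp i b c).WF := ⟨hb, hc, hi, h₂⟩
    have w₃ : (Raw.comp i (.comp i a b) c).WF := by
      refine ⟨w₁, hc, hi, ?_⟩
      rcases hi.lt_or_eq with him | rfl
      · simp only [Raw.tgt, him, if_true]
        rw [B.t_comp (by rw [h₁, (hb.parallel him).1]), h₂]
      · simpa [Raw.tgt] using h₂
    have w₄ : (Raw.comp i a (.comp i b c)).WF := by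
      refine ⟨ha, w₂, hi, ?_⟩
      rcases hi.lt_or_eq with him | rfl
      · simp only [Raw.src, him, if_true]
        rw [B.s_comp (by rw [(hb.parallel him).2, h₂]), h₁]
      · simpa [Raw.src] using h₁
    rw [comp_cls i ha hb w₁, comp_cls i w₁ hc w₃, comp_cls i hb hc w₂, comp_cls i ha w₂ w₄]
    exact cls_eq (.ax (.assoc i a b c) w₃ w₄)
  exchange {i j x y z v} hij hj := by
    induction x using Cells.ind with | _ a ha
    induction y using Cells.ind with | _ b hb
    induction z using Cells.ind with | _ c hc
    induction v using Cells.ind with | _ d hd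
    intro h₁ h₂ h₃
    change B.t j a.tgt = B.s j b.src at h₁
    change B.t j c.tgt = B.s j d.src at h₂
    change B.t i a.tgt = B.s i c.src at h₃
    have him : i < m := by omega
    have h₄ : B.t i b.tgt = B.s i d.src := by
      rw [← (hb.parallel him).2, ← B.t_s hij, ← h₁, B.t_t hij.le, h₃, (hc.parallel him).1,
        ← B.s_t hij, h₂, B.s_s hij.le]
    have w₁ : (Raw.comp j a b).WF := ⟨ha, hb, hj, h₁⟩
    have w₂ : (Raw.comp j c d).WF := ⟨hc, hd, hj, h₂⟩
    have w₃ : (Raw.comp i a c).WF := ⟨ha, hc, him.le, h₃⟩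
    have w₄ : (Raw.comp i b d).WF := ⟨hb, hd, him.le, h₄⟩
    have w₅ : (Raw.comp i (.comp j a b) (.comp j c d)).WF := by
      refine ⟨w₁, w₂, him.le, ?_⟩
      rcases hj.lt_or_eq with hjm | rfl
      · simp only [Raw.tgt, Raw.src, hjm, if_true]
        rw [B.t_comp_gt hij (by rw [h₁, (hb.parallel hjm).1]),
          B.s_comp_gt hij (by rw [(hc.parallel hjm).2, h₂]), h₄, ← B.s_s hij.le, ← h₂,
          B.s_t hij, (hc.parallel him).1]
      · simp only [Raw.tgt, Raw.src, lt_irrefl, if_false]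
        rw [h₄, ← B.s_s hij.le, ← h₂, B.s_t hij, (hc.parallel him).1]
    have w₆ : (Raw.comp j (.comp i a c) (.comp i b d)).WF := by
      refine ⟨w₃, w₄, hj, ?_⟩
      simp only [Raw.tgt, Raw.src, him, if_true]
      rw [B.t_comp_lt hij (by rw [h₃, (hc.parallel him).1]),
        B.s_comp_lt hij (by rw [(hb.parallel him).2, h₄]), h₁, h₂]
    rw [comp_cls j ha hb w₁, comp_cls j hc hd w₂, comp_cls i w₁ w₂ w₅, comp_cls i ha hc w₃,
      comp_cls i hb hd w₄, comp_cls j w₃ w₄ w₆]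
    exact cls_eq (.ax (.exchange i j a b c d hij) w₅ w₆)

section

variable {Γ : CellExt B} {X : Raw Γ → Raw Γ → Prop}

/-- The cell given by a generator. -/
def ofGen (X : Raw Γ → Raw Γ → Prop) (γ : Γ.Gen) : (present Γ X).Cell := cls X (.gen γ) trivial

/-- The length of a cell: the least number of generators in a formal composite that represents it.
In a free `(m+1)`-category all the formal composites that represent a cell have the same number of
generators (see `length_free`). -/
noncomputable def length (x : (present Γ X).Cell) : ℕ :=
  sInf {k | ∃ (a : Raw Γ) (h : a.WF), cls X a h = x ∧ a.count = k}

/-- The value of a formal composite, for given values of the generators. -/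
def Raw.eval (D : ExtCat B) (φ : Γ.Gen → D.Cell) : Raw Γ → D.Cell
  | .gen γ => φ γ
  | .one x => D.one x
  | .comp i a b => D.comp i (a.eval D φ) (b.eval D φ)

theorem Raw.eval_boundary {D : ExtCat B} {φ : Γ.Gen → D.Cell} (hs : ∀ γ, D.src (φ γ) = Γ.src γ)
    (ht : ∀ γ, D.tgt (φ γ) = Γ.tgt γ) :
    ∀ {a : Raw Γ}, a.WF → D.src (a.eval D φ) = a.src ∧ D.tgt (a.eval D φ) = a.tgt
  | .gen γ, _ => ⟨hs γ, ht γ⟩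
  | .one _, _ => ⟨D.src_one, D.tgt_one⟩
  | .comp i a b, ⟨ha, hb, hi, h⟩ => by
    have pa := Raw.eval_boundary hs ht ha
    have pb := Raw.eval_boundary hs ht hb
    have h' : B.t i (D.tgt (a.eval D φ)) = B.s i (D.src (b.eval D φ)) := by rw [pa.2, pb.1, h]
    rcases hi.lt_or_eq with him | rfl
    · simp only [Raw.eval, Raw.src, Raw.tgt, him, if_true]
      rw [D.src_comp_lt him h', D.tgt_comp_lt him h', pa.1, pa.2, pb.1, pb.2]
      exact ⟨rfl, rfl⟩
    · simp only [Raw.eval, Raw.src, Raw.tgt, lt_irrefl, if_false]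
      rw [D.src_comp (D.comp_top h'), D.tgt_comp (D.comp_top h'), pa.1, pb.2]
      exact ⟨rfl, rfl⟩

theorem Rel.eval {D : ExtCat B} {φ : Γ.Gen → D.Cell} (hs : ∀ γ, D.src (φ γ) = Γ.src γ)
    (ht : ∀ γ, D.tgt (φ γ) = Γ.tgt γ) (hX : ∀ a b, X a b → a.eval D φ = b.eval D φ)
    {a b : Raw Γ} (h : Rel Γ X a b) : a.eval D φ = b.eval D φ := by
  induction h with
  | refl a => rfl
  | symm _ ih => exact ih.symm
  | trans _ _ ih₁ ih₂ => exact ih₁.trans ih₂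
  | congr i _ _ ih₁ ih₂ => simp only [Raw.eval, ih₁, ih₂]
  | rel h _ _ _ _ => exact hX _ _ h
  | ax h ha hb =>
    have bd : ∀ {a : Raw Γ}, a.WF → _ := fun {a} => Raw.eval_boundary (a := a) hs ht
    cases h with
    | assoc i a b c =>
      obtain ⟨⟨wa, wb, hi, h1⟩, wc, -, h2⟩ := ha
      obtain ⟨-, ⟨-, -, -, h3⟩, -, h4⟩ := hb
      exact D.assoc hi (by rw [(bd wa).2, (bd wb).1, h1]) (by rw [(bd wb).2, (bd wc).1, h3])
    | id_comp i a =>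
      simp only [Raw.eval]
      rw [← (bd hb).1, D.id_comp ha.2.2.1]
    | comp_id i a =>
      simp only [Raw.eval]
      rw [← (bd hb).2, D.comp_id ha.2.2.1]
    | one_comp i x y h => exact D.one_comp h hb.2.2.2
    | exchange i j a b c d hij =>
      obtain ⟨⟨wa, wb, hj, h1⟩, ⟨wc, wd, -, h2⟩, hi, h3⟩ := ha
      obtain ⟨⟨-, -, -, h4⟩, ⟨-, -, -, h5⟩, -, h6⟩ := hb
      exact D.exchange hij hj (by rw [(bd wa).2, (bd wb).1, h1]) (by rw [(bd wc).2, (bd wd).1, h2])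
        (by rw [(bd wa).2, (bd wc).1, h4])

/-- The functor out of a presented `(m+1)`-category given by the images of the generators. -/
noncomputable def lift (D : ExtCat B) (φ : Γ.Gen → D.Cell) (hs : ∀ γ, D.src (φ γ) = Γ.src γ)
    (ht : ∀ γ, D.tgt (φ γ) = Γ.tgt γ) (hX : ∀ a b, X a b → a.eval D φ = b.eval D φ) :
    (present Γ X).Hom D where
  map x := Quotient.lift (s := relSetoid Γ X) (fun a => a.1.eval D φ)
    (fun _ _ h => Rel.eval hs ht hX h) x
  src_map x := by
    induction x using Cells.ind with | _ a ha
    exact (Raw.eval_boundary hs ht ha).1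
  tgt_map x := by
    induction x using Cells.ind with | _ a ha
    exact (Raw.eval_boundary hs ht ha).2
  map_one _ := rfl
  map_comp i x y hi := by
    induction x using Cells.ind with | _ a ha
    induction y using Cells.ind with | _ b hb
    intro h
    change Quotient.lift (s := relSetoid Γ X) _ _ (Cells.comp i _ _) = _
    rw [comp_cls i ha hb ⟨ha, hb, hi, h⟩]
    rfl

end

/-- No relations. -/
def noRel (Γ : CellExt B) : Raw Γ → Raw Γ → Prop := fun _ _ => False

/-- The free `(m+1)`-category `B[Γ]` generated by `Γ` over `B`. -/
noncomputable def free (Γ : CellExt B) : ExtCat B := present Γ Γ.noRel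

theorem Rel.count_eq {Γ : CellExt B} {a b : Raw Γ} (h : Rel Γ Γ.noRel a b) : a.count = b.count := by
  induction h with
  | refl a => rfl
  | symm _ ih => exact ih.symm
  | trans _ _ ih₁ ih₂ => exact ih₁.trans ih₂
  | congr i _ _ ih₁ ih₂ => simp only [Raw.count, ih₁, ih₂]
  | rel h _ _ _ _ => exact h.elim
  | ax h _ _ => cases h <;> simp only [Raw.count] <;> omega

theorem length_free {Γ : CellExt B} (a : Raw Γ) (h : a.WF) :
    length (cls Γ.noRel a h : Γ.free.Cell) = a.count := by
  have : {k | ∃ (b : Raw Γ) (hb : b.WF), cls Γ.noRel b hb = cls Γ.noRel a h ∧ b.count = k} =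
      {a.count} := by
    ext k
    constructor
    · rintro ⟨b, hb, h', rfl⟩
      exact (cls_exact h').count_eq
    · rintro rfl
      exact ⟨a, h, rfl, rfl⟩
  unfold length
  rw [this, csInf_singleton]

/-- The cellular extension `Γ ∪ Δ`. -/
def add (Γ Δ : CellExt B) : CellExt B where
  Gen := Γ.Gen ⊕ Δ.Gen
  src := Sum.elim Γ.src Δ.src
  tgt := Sum.elim Γ.tgt Δ.tgt
  s_src {i γ} h := by cases γ <;> simp [Γ.s_src h, Δ.s_src h]
  t_src {i γ} h := by cases γ <;> simp [Γ.t_src h, Δ.t_src h]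

/-- The cellular extension `Γ⁻`: the elements of `Γ` with source and target reversed. -/
def op (Γ : CellExt B) : CellExt B where
  Gen := Γ.Gen
  src := Γ.tgt
  tgt := Γ.src
  s_src h := (Γ.s_src h).symm
  t_src h := (Γ.t_src h).symm

/-- The part of `Γ` on a subset of its elements. -/
def restrict (Γ : CellExt B) (A : Set Γ.Gen) : CellExt B where
  Gen := A
  src γ := Γ.src γ
  tgt γ := Γ.tgt γ
  s_src h := Γ.s_src h
  t_src h := Γ.t_src h

/-- The image of a cellular extension under a functor. -/
def push {C D : NCat.{u} m} (F : NFunctor C D) (Γ : CellExt C) : CellExt D where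
  Gen := Γ.Gen
  src γ := F.map (Γ.src γ)
  tgt γ := F.map (Γ.tgt γ)
  s_src h := by rw [← F.map_s, ← F.map_s, Γ.s_src h]
  t_src h := by rw [← F.map_t, ← F.map_t, Γ.t_src h]

/-- The relations that make the generators `p k` and `q k` mutually inverse. -/
inductive InvRel (Λ : CellExt B) {ι : Type u} (p q : ι → Λ.Gen) : Raw Λ → Raw Λ → Prop
  | left (k : ι) : InvRel Λ p q (.comp m (.gen (p k)) (.gen (q k))) (.one (Λ.src (p k)))
  | right (k : ι) : InvRel Λ p q (.comp m (.gen (q k)) (.gen (p k))) (.one (Λ.tgt (p k)))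

/-- The free `(m+1,m)`-category `B(Γ)` generated by `Γ` over `B`: the quotient of `B[Γ, Γ⁻]` that
makes each generator of `Γ` inverse to its copy in `Γ⁻`. -/
noncomputable def freeInv (Γ : CellExt B) : ExtCat B :=
  present (Γ.add Γ.op) (InvRel (ι := Γ.Gen) (Γ.add Γ.op) Sum.inl Sum.inr)

/-- The `(m+1)`-category `B[Γ, Δ, Δ⁻]/Inv(Δ, Δ⁻)`. -/
noncomputable def freeMixed (Γ Δ : CellExt B) : ExtCat B :=
  present (Γ.add (Δ.add Δ.op)) (InvRel (ι := Δ.Gen) (Γ.add (Δ.add Δ.op))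
    (fun k => Sum.inr (Sum.inl k)) (fun k => Sum.inr (Sum.inr k)))

end CellExt

/-- `n`-polygraphs together with the free `n`-categories they generate, by induction on `n`: a
`0`-polygraph is a set, and an `(n+1)`-polygraph is an `n`-polygraph `P` with a cellular extension
of the free `n`-category on `P`. -/
noncomputable def PolyAux : (n : ℕ) → (P : Type (u + 1)) × (P → NCat.{u} n)
  | 0 => ⟨Type u, NCat.disc⟩
  | n + 1 => ⟨(P : (PolyAux n).1) × CellExt ((PolyAux n).2 P), fun P => P.2.free.toNCat⟩

/-- `n`-polygraphs. -/
def Polygraph (n : ℕ) : Type (u + 1) := (PolyAux.{u} n).1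

namespace Polygraph

/-- The free `n`-category generated by an `n`-polygraph. -/
noncomputable def freeCat {n : ℕ} (P : Polygraph.{u} n) : NCat.{u} n := (PolyAux.{u} n).2 P

/-- The underlying `n`-polygraph of an `(n+1)`-polygraph. -/
def trunc {n : ℕ} (P : Polygraph.{u} (n + 1)) : Polygraph.{u} n := Sigma.fst P

/-- The generating `(n+1)`-cells of an `(n+1)`-polygraph. -/
def top {n : ℕ} (P : Polygraph.{u} (n + 1)) : CellExt P.trunc.freeCat := Sigma.snd P

/-- The `(n+1)`-polygraph given by an `n`-polygraph and a set of generating `(n+1)`-cells. -/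
noncomputable def extend {n : ℕ} (P : Polygraph.{u} n) (Γ : CellExt P.freeCat) : Polygraph.{u} (n + 1) :=
  Sigma.mk P Γ

/-- The set of generating `n`-cells of an `n`-polygraph. -/
def TopGen : {n : ℕ} → Polygraph.{u} n → Type u
  | 0, X => X
  | _ + 1, P => P.top.Gen

/-- The sub-`n`-polygraph with the same generating `k`-cells for `k < n`, and with the generating
`n`-cells in `A`. -/
noncomputable def restrictTop : {n : ℕ} → (P : Polygraph.{u} n) → Set P.TopGen → Polygraph.{u} n
  | 0, P, A => show Type u from {x : TopGen P // x ∈ A}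
  | _ + 1, P, A => P.trunc.extend (P.top.restrict A)

/-- The functor induced by the inclusion of `P.restrictTop A` in `P`. -/
noncomputable def incl : {n : ℕ} → (P : Polygraph.{u} n) → (A : Set P.TopGen) →
    NFunctor (P.restrictTop A).freeCat P.freeCat
  | 0, P, A =>
    { map := fun (x : {x : TopGen P // x ∈ A}) => x.1
      map_s := fun _ _ => rfl
      map_t := fun _ _ => rfl
      map_comp := fun _ _ _ _ => rfl }
  | _ + 1, P, A =>
    (CellExt.lift (Γ := P.top.restrict A) (X := CellExt.noRel _) P.top.free
      (fun γ => CellExt.ofGen _ γ.1) (fun _ => rfl) (fun _ => rfl)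
      (fun _ _ h => h.elim)).toNFunctor

end Polygraph

section Modulo

variable {m : ℕ} {B : NCat.{u} m}

namespace CellExt

/-- The cellular extension `_E R_E` of `B`: its elements are the triples `(e, f, e')` that compose,
with `e`, `e'` in the free `(m+1,m)`-category on `E` and `f` of length one in the free
`(m+1)`-category on `R`; such a triple goes from the source of `e` to the target of `e'`. -/
noncomputable def modulo (R E : CellExt B) : CellExt B where
  Gen := {x : E.freeInv.Cell × R.free.Cell × E.freeInv.Cell //
    length x.2.1 = 1 ∧ E.freeInv.tgt x.1 = R.free.src x.2.1 ∧
      R.free.tgt x.2.1 = E.freeInv.src x.2.2}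
  src x := E.freeInv.src x.1.1
  tgt x := E.freeInv.tgt x.1.2.2
  s_src {i x} h := by
    rw [E.freeInv.s_src h, x.2.2.1, R.free.s_src h, x.2.2.2, E.freeInv.s_src h]
  t_src {i x} h := by
    rw [E.freeInv.t_src h, x.2.2.1, R.free.t_src h, x.2.2.2, E.freeInv.t_src h]

/-- The element `(1, r, 1)` of `_E R_E` given by a generator `r` of `R`. -/
noncomputable def moduloOfGen (R E : CellExt B) (r : R.Gen) : (modulo R E).Gen :=
  ⟨(E.freeInv.one (R.src r), ofGen _ r, E.freeInv.one (R.tgt r)),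
    length_free (.gen r) trivial, rfl, rfl⟩

/-- The `(m+1)`-cell `f` is a rewriting step of the free `(m+1)`-category on `Γ`. -/
def IsStep {Γ : CellExt B} (f : Γ.free.Cell) : Prop := length f = 1

/-- `Γ` is terminating: there is no infinite sequence of rewriting steps. -/
def Terminating (Γ : CellExt B) : Prop :=
  ¬ ∃ u : ℕ → B.Cell, ∀ k, ∃ f : Γ.free.Cell,
    IsStep f ∧ Γ.free.src f = u k ∧ Γ.free.tgt f = u (k + 1)

/-- The functor from the free `(m+1)`-category on `R` to `B[R, E, E⁻]/Inv(E, E⁻)`. -/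
noncomputable def mixR (R E : CellExt B) : R.free.Hom (freeMixed R E) :=
  lift _ (fun r => ofGen _ (Sum.inl r)) (fun _ => rfl) (fun _ => rfl) (fun _ _ h => h.elim)

/-- The functor from the free `(m+1,m)`-category on `E` to `B[R, E, E⁻]/Inv(E, E⁻)`. -/
noncomputable def mixE (R E : CellExt B) : E.freeInv.Hom (freeMixed R E) :=
  lift _ (fun e => ofGen _ (Sum.inr e)) (fun e => by cases e <;> rfl) (fun e => by cases e <;> rfl)
    (by
      rintro _ _ (k | k)
      · have w : (Raw.comp m (.gen (Sum.inr (Sum.inl k))) (.gen (Sum.inr (Sum.inr k))) :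
            Raw (R.add (E.add E.op))).WF :=
          ⟨trivial, trivial, le_rfl, by rw [B.t_top le_rfl, B.s_top le_rfl]; rfl⟩
        refine (comp_cls m (a := .gen _) (b := .gen _) trivial trivial w).trans ?_
        refine cls_eq (.rel (.left k) w trivial ?_ ?_)
        · simp [Raw.src, add]
        · simp [Raw.tgt, add, op]
      · have w : (Raw.comp m (.gen (Sum.inr (Sum.inr k))) (.gen (Sum.inr (Sum.inl k))) :
            Raw (R.add (E.add E.op))).WF :=
          ⟨trivial, trivial, le_rfl, by rw [B.t_top le_rfl, B.s_top le_rfl]; rfl⟩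
        refine (comp_cls m (a := .gen _) (b := .gen _) trivial trivial w).trans ?_
        refine cls_eq (.rel (.right k) w trivial ?_ ?_)
        · simp [Raw.src, add, op]
        · simp [Raw.tgt, add])

/-- The functor from the free `(m+1)`-category on `S ⊆ _E R_E` to `B[R, E, E⁻]/Inv(E, E⁻)` that
sends the generator `(e, f, e')` to `e ⋆_m f ⋆_m e'`. -/
noncomputable def mixS (R E : CellExt B) (S : Set (modulo R E).Gen) :
    ((modulo R E).restrict S).free.Hom (freeMixed R E) :=
  lift _
    (fun x => (freeMixed R E).comp m ((freeMixed R E).comp m ((mixE R E).map x.1.1.1)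
      ((mixR R E).map x.1.1.2.1)) ((mixE R E).map x.1.1.2.2))
    (fun x => by
      have h₁ : (freeMixed R E).tgt ((mixE R E).map x.1.1.1) =
          (freeMixed R E).src ((mixR R E).map x.1.1.2.1) := by
        rw [ExtCat.Hom.tgt_map, ExtCat.Hom.src_map, x.1.2.2.1]
      have h₂ : (freeMixed R E).tgt ((mixR R E).map x.1.1.2.1) =
          (freeMixed R E).src ((mixE R E).map x.1.1.2.2) := by
        rw [ExtCat.Hom.tgt_map, ExtCat.Hom.src_map, x.1.2.2.2]
      rw [ExtCat.src_comp _ (by rw [ExtCat.tgt_comp _ h₁, h₂]), ExtCat.src_comp _ h₁, ExtCat.Hom.src_map]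
      rfl)
    (fun x => by
      have h₁ : (freeMixed R E).tgt ((mixE R E).map x.1.1.1) =
          (freeMixed R E).src ((mixR R E).map x.1.1.2.1) := by
        rw [ExtCat.Hom.tgt_map, ExtCat.Hom.src_map, x.1.2.2.1]
      have h₂ : (freeMixed R E).tgt ((mixR R E).map x.1.1.2.1) =
          (freeMixed R E).src ((mixE R E).map x.1.1.2.2) := by
        rw [ExtCat.Hom.tgt_map, ExtCat.Hom.src_map, x.1.2.2.2]
      rw [ExtCat.tgt_comp _ (by rw [ExtCat.tgt_comp _ h₁, h₂]), ExtCat.Hom.tgt_map]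
      rfl)
    (fun _ _ h => h.elim)

end CellExt

end Modulo

/-- A square extension of a pair `(V, H)` of `(m+1)`-categories with the same underlying
`m`-category `B`. A square `A` has the horizontal source `hs A` (top), the horizontal target
`ht A` (bottom), the vertical source `vs A` (left) and the vertical target `vt A` (right). -/
structure SquareExt {m : ℕ} {B : NCat.{u} m} (V H : ExtCat B) where
  Sq : Type u
  hs : Sq → H.Cell
  ht : Sq → H.Cell
  vs : Sq → V.Cell
  vt : Sq → V.Cell
  src_vs : ∀ A, V.src (vs A) = H.src (hs A)
  tgt_vs : ∀ A, V.tgt (vs A) = H.src (ht A)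
  src_vt : ∀ A, V.src (vt A) = H.tgt (hs A)
  tgt_vt : ∀ A, V.tgt (vt A) = H.tgt (ht A)

namespace SquareExt

variable {m : ℕ} {B : NCat.{u} m} {V H : ExtCat B}

/-- The union of two square extensions. -/
def union (Γ Δ : SquareExt V H) : SquareExt V H where
  Sq := Γ.Sq ⊕ Δ.Sq
  hs := Sum.elim Γ.hs Δ.hs
  ht := Sum.elim Γ.ht Δ.ht
  vs := Sum.elim Γ.vs Δ.vs
  vt := Sum.elim Γ.vt Δ.vt
  src_vs := by rintro (A | A) <;> simp [Γ.src_vs, Δ.src_vs]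
  tgt_vs := by rintro (A | A) <;> simp [Γ.tgt_vs, Δ.tgt_vs]
  src_vt := by rintro (A | A) <;> simp [Γ.src_vt, Δ.src_vt]
  tgt_vt := by rintro (A | A) <;> simp [Γ.tgt_vt, Δ.tgt_vt]

/-- The Peiffer squares of the first kind: for `f : u → u'` in `H` and `e : v → v'` in `V`, the
square with top `f ⋆_i v`, bottom `f ⋆_i v'`, left `u ⋆_i e` and right `u' ⋆_i e`. -/
def peiffer₁ (V H : ExtCat B) : SquareExt V H where
  Sq := {x : ℕ × H.Cell × V.Cell // x.1 < m ∧ B.t x.1 (H.tgt x.2.1) = B.s x.1 (V.src x.2.2)}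
  hs x := H.comp x.1.1 x.1.2.1 (H.one (V.src x.1.2.2))
  ht x := H.comp x.1.1 x.1.2.1 (H.one (V.tgt x.1.2.2))
  vs x := V.comp x.1.1 (V.one (H.src x.1.2.1)) x.1.2.2
  vt x := V.comp x.1.1 (V.one (H.tgt x.1.2.1)) x.1.2.2
  src_vs := by
    rintro ⟨⟨i, f, e⟩, hi, h⟩
    dsimp only at hi h ⊢
    rw [V.src_comp_lt hi (by rw [V.tgt_one, H.t_src hi, h]),
      H.src_comp_lt hi (by rw [H.src_one, h]), V.src_one, H.src_one]
  tgt_vs := by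
    rintro ⟨⟨i, f, e⟩, hi, h⟩
    dsimp only at hi h ⊢
    rw [V.tgt_comp_lt hi (by rw [V.tgt_one, H.t_src hi, h]),
      H.src_comp_lt hi (by rw [H.src_one, h, V.s_src hi]), V.tgt_one, H.src_one]
  src_vt := by
    rintro ⟨⟨i, f, e⟩, hi, h⟩
    dsimp only at hi h ⊢
    rw [V.src_comp_lt hi (by rw [V.tgt_one, h]),
      H.tgt_comp_lt hi (by rw [H.src_one, h]), V.src_one, H.tgt_one]
  tgt_vt := by
    rintro ⟨⟨i, f, e⟩, hi, h⟩
    dsimp only at hi h ⊢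
    rw [V.tgt_comp_lt hi (by rw [V.tgt_one, h]),
      H.tgt_comp_lt hi (by rw [H.src_one, h, V.s_src hi]), V.tgt_one, H.tgt_one]

/-- The Peiffer squares of the second kind: for `f : u → u'` in `H` and `e : w → w'` in `V`, the
square with top `w ⋆_i f`, bottom `w' ⋆_i f`, left `e ⋆_i u` and right `e ⋆_i u'`. -/
def peiffer₂ (V H : ExtCat B) : SquareExt V H where
  Sq := {x : ℕ × H.Cell × V.Cell // x.1 < m ∧ B.t x.1 (V.tgt x.2.2) = B.s x.1 (H.src x.2.1)}
  hs x := H.comp x.1.1 (H.one (V.src x.1.2.2)) x.1.2.1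
  ht x := H.comp x.1.1 (H.one (V.tgt x.1.2.2)) x.1.2.1
  vs x := V.comp x.1.1 x.1.2.2 (V.one (H.src x.1.2.1))
  vt x := V.comp x.1.1 x.1.2.2 (V.one (H.tgt x.1.2.1))
  src_vs := by
    rintro ⟨⟨i, f, e⟩, hi, h⟩
    dsimp only at hi h ⊢
    rw [V.src_comp_lt hi (by rw [V.src_one, h]),
      H.src_comp_lt hi (by rw [H.tgt_one, V.t_src hi, h]), V.src_one, H.src_one]
  tgt_vs := by
    rintro ⟨⟨i, f, e⟩, hi, h⟩
    dsimp only at hi h ⊢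
    rw [V.tgt_comp_lt hi (by rw [V.src_one, h]),
      H.src_comp_lt hi (by rw [H.tgt_one, h]), V.tgt_one, H.src_one]
  src_vt := by
    rintro ⟨⟨i, f, e⟩, hi, h⟩
    dsimp only at hi h ⊢
    rw [V.src_comp_lt hi (by rw [V.src_one, h, H.s_src hi]),
      H.tgt_comp_lt hi (by rw [H.tgt_one, V.t_src hi, h]), V.src_one, H.tgt_one]
  tgt_vt := by
    rintro ⟨⟨i, f, e⟩, hi, h⟩
    dsimp only at hi h ⊢
    rw [V.tgt_comp_lt hi (by rw [V.src_one, h, H.s_src hi]),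
      H.tgt_comp_lt hi (by rw [H.tgt_one, h]), V.tgt_one, H.tgt_one]

/-- The Peiffer square extension of the pair `(V, H)`. -/
def peiffer (V H : ExtCat B) : SquareExt V H := (peiffer₁ V H).union (peiffer₂ V H)

/-- Formal pastings of elements of `Γ` and identity squares: `idh f` and `idv e` are the identity
squares on a horizontal cell `f` and on a vertical cell `e`; `vcomp a b` is `a ⋄^v b` (`a` on the
left of `b`); `hcomp a b` is `a ⋄^h b` (`a` above `b`); `star i a b` is `a ⋆_i b`; and
`inv a e e'` is the inverse of `a` for `⋄^h`, where `e` and `e'` are the inverses of the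
vertical source and of the vertical target of `a`. -/
inductive Raw (Γ : SquareExt V H) : Type u
  | gen (A : Γ.Sq) : Raw Γ
  | idh (f : H.Cell) : Raw Γ
  | idv (e : V.Cell) : Raw Γ
  | vcomp (a b : Raw Γ) : Raw Γ
  | hcomp (a b : Raw Γ) : Raw Γ
  | star (i : ℕ) (a b : Raw Γ) : Raw Γ
  | inv (a : Raw Γ) (e e' : V.Cell) : Raw Γ

/-- Quadruples of two horizontal and two vertical cells. -/
structure Boundary (V H : ExtCat B) where
  hs : H.Cell
  ht : H.Cell
  vs : V.Cell
  vt : V.Cell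

/-- The four cells bound a square. -/
structure Boundary.IsSquare (q : Boundary V H) : Prop where
  src_vs : V.src q.vs = H.src q.hs
  tgt_vs : V.tgt q.vs = H.src q.ht
  src_vt : V.src q.vt = H.tgt q.hs
  tgt_vt : V.tgt q.vt = H.tgt q.ht

namespace Raw

variable {Γ : SquareExt V H}

/-- The boundary of a formal pasting. -/
def bd : Raw Γ → Boundary V H
  | gen A => ⟨Γ.hs A, Γ.ht A, Γ.vs A, Γ.vt A⟩
  | idh f => ⟨f, f, V.one (H.src f), V.one (H.tgt f)⟩
  | idv e => ⟨H.one (V.src e), H.one (V.tgt e), e, e⟩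
  | vcomp a b => ⟨H.comp m a.bd.hs b.bd.hs, H.comp m a.bd.ht b.bd.ht, a.bd.vs, b.bd.vt⟩
  | hcomp a b => ⟨a.bd.hs, b.bd.ht, V.comp m a.bd.vs b.bd.vs, V.comp m a.bd.vt b.bd.vt⟩
  | star i a b => ⟨H.comp i a.bd.hs b.bd.hs, H.comp i a.bd.ht b.bd.ht,
      V.comp i a.bd.vs b.bd.vs, V.comp i a.bd.vt b.bd.vt⟩
  | inv a e e' => ⟨a.bd.ht, a.bd.hs, e, e'⟩

/-- All the compositions in the formal pasting make sense. -/
def WF : Raw Γ → Prop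
  | gen _ => True
  | idh _ => True
  | idv _ => True
  | vcomp a b => a.WF ∧ b.WF ∧ a.bd.vt = b.bd.vs
  | hcomp a b => a.WF ∧ b.WF ∧ a.bd.ht = b.bd.hs
  | star i a b => a.WF ∧ b.WF ∧ i < m ∧ B.t i (H.tgt a.bd.hs) = B.s i (H.src b.bd.hs)
  | inv a e e' => a.WF ∧ V.IsInverse a.bd.vs e ∧ V.IsInverse a.bd.vt e'

end Raw

/-- The axioms of `m`-categories enriched in double categories in which squares are invertible for
`⋄^h`, as pairs of formal pastings. -/
inductive Ax (Γ : SquareExt V H) : Raw Γ → Raw Γ → Prop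
  -- the category of squares with the composition `⋄^v`
  | v_assoc (a b c : Raw Γ) : Ax Γ (.vcomp (.vcomp a b) c) (.vcomp a (.vcomp b c))
  | v_id_comp (a : Raw Γ) : Ax Γ (.vcomp (.idv a.bd.vs) a) a
  | v_comp_id (a : Raw Γ) : Ax Γ (.vcomp a (.idv a.bd.vt)) a
  -- the category of squares with the composition `⋄^h`, and inverses
  | h_assoc (a b c : Raw Γ) : Ax Γ (.hcomp (.hcomp a b) c) (.hcomp a (.hcomp b c))
  | h_id_comp (a : Raw Γ) : Ax Γ (.hcomp (.idh a.bd.hs) a) a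
  | h_comp_id (a : Raw Γ) : Ax Γ (.hcomp a (.idh a.bd.ht)) a
  | h_comp_inv (a : Raw Γ) (e e' : V.Cell) : Ax Γ (.hcomp a (.inv a e e')) (.idh a.bd.hs)
  | h_inv_comp (a : Raw Γ) (e e' : V.Cell) : Ax Γ (.hcomp (.inv a e e') a) (.idh a.bd.ht)
  -- functoriality of identities, middle four interchange law
  | idv_comp (e e' : V.Cell) : Ax Γ (.idv (V.comp m e e')) (.hcomp (.idv e) (.idv e'))
  | idh_comp (f f' : H.Cell) : Ax Γ (.idh (H.comp m f f')) (.vcomp (.idh f) (.idh f'))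
  | id_one (x : B.Cell) : Ax Γ (.idv (V.one x)) (.idh (H.one x))
  | interchange (a a' b b' : Raw Γ) :
      Ax Γ (.hcomp (.vcomp a a') (.vcomp b b')) (.vcomp (.hcomp a b) (.hcomp a' b'))
  -- the compositions `⋆_i` are associative, unital, satisfy the exchange relations, and are
  -- functors of double categories
  | star_assoc (i : ℕ) (a b c : Raw Γ) :
      Ax Γ (.star i (.star i a b) c) (.star i a (.star i b c))
  | star_id_comp (i : ℕ) (a : Raw Γ) :
      Ax Γ (.star i (.idh (H.one (B.s i (H.src a.bd.hs)))) a) a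
  | star_comp_id (i : ℕ) (a : Raw Γ) :
      Ax Γ (.star i a (.idh (H.one (B.t i (H.tgt a.bd.hs))))) a
  | star_exchange (i j : ℕ) (a b c d : Raw Γ) (h : i < j) :
      Ax Γ (.star i (.star j a b) (.star j c d)) (.star j (.star i a c) (.star i b d))
  | star_vcomp (i : ℕ) (a b c d : Raw Γ) :
      Ax Γ (.star i (.vcomp a b) (.vcomp c d)) (.vcomp (.star i a c) (.star i b d))
  | star_hcomp (i : ℕ) (a b c d : Raw Γ) :
      Ax Γ (.star i (.hcomp a b) (.hcomp c d)) (.hcomp (.star i a c) (.star i b d))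
  | star_idh (i : ℕ) (f f' : H.Cell) : Ax Γ (.idh (H.comp i f f')) (.star i (.idh f) (.idh f'))
  | star_idv (i : ℕ) (e e' : V.Cell) : Ax Γ (.idv (V.comp i e e')) (.star i (.idv e) (.idv e'))

/-- The congruence on formal pastings generated by the axioms. -/
inductive Rel (Γ : SquareExt V H) : Raw Γ → Raw Γ → Prop
  | refl (a : Raw Γ) : Rel Γ a a
  | symm {a b : Raw Γ} : Rel Γ a b → Rel Γ b a
  | trans {a b c : Raw Γ} : Rel Γ a b → Rel Γ b c → Rel Γ a c
  | vcomp {a a' b b' : Raw Γ} : Rel Γ a a' → Rel Γ b b' → Rel Γ (.vcomp a b) (.vcomp a' b')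
  | hcomp {a a' b b' : Raw Γ} : Rel Γ a a' → Rel Γ b b' → Rel Γ (.hcomp a b) (.hcomp a' b')
  | star (i : ℕ) {a a' b b' : Raw Γ} :
      Rel Γ a a' → Rel Γ b b' → Rel Γ (.star i a b) (.star i a' b')
  | inv {a a' : Raw Γ} (e e' : V.Cell) : Rel Γ a a' → Rel Γ (.inv a e e') (.inv a' e e')
  | ax {a b : Raw Γ} : Ax Γ a b → a.WF → b.WF → Rel Γ a b

section

variable {Γ : SquareExt V H}

/-- If the boundaries of two squares are `i`-composable at one corner, they are so everywhere. -/
theorem Boundary.IsSquare.star {p q : Boundary V H} (hp : p.IsSquare) (hq : q.IsSquare) {i : ℕ}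
    (hi : i < m) (h : B.t i (H.tgt p.hs) = B.s i (H.src q.hs)) :
    B.t i (H.tgt p.ht) = B.s i (H.src q.ht) ∧ B.t i (V.tgt p.vs) = B.s i (V.src q.vs) ∧
      B.t i (V.tgt p.vt) = B.s i (V.src q.vt) := by
  refine ⟨?_, ?_, ?_⟩
  · rw [← hp.tgt_vt, ← V.t_src hi, hp.src_vt, h, ← hq.src_vs, V.s_src hi, hq.tgt_vs]
  · rw [← V.t_src hi, hp.src_vs, H.t_src hi, h, hq.src_vs]
  · rw [← V.t_src hi, hp.src_vt, h, H.s_src hi, hq.src_vt]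

theorem Raw.WF.isSquare : ∀ {a : Raw Γ}, a.WF → a.bd.IsSquare
  | .gen A, _ => ⟨Γ.src_vs A, Γ.tgt_vs A, Γ.src_vt A, Γ.tgt_vt A⟩
  | .idh f, _ => ⟨V.src_one, V.tgt_one, V.src_one, V.tgt_one⟩
  | .idv e, _ => ⟨H.src_one.symm, H.src_one.symm, H.tgt_one.symm, H.tgt_one.symm⟩
  | .vcomp a b, ⟨ha, hb, h⟩ => by
    have pa := Raw.WF.isSquare ha
    have pb := Raw.WF.isSquare hb
    have h₁ : H.tgt a.bd.hs = H.src b.bd.hs := by rw [← pa.src_vt, h, pb.src_vs]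
    have h₂ : H.tgt a.bd.ht = H.src b.bd.ht := by rw [← pa.tgt_vt, h, pb.tgt_vs]
    constructor <;> simp only [Raw.bd]
    · rw [H.src_comp h₁, pa.src_vs]
    · rw [H.src_comp h₂, pa.tgt_vs]
    · rw [H.tgt_comp h₁, pb.src_vt]
    · rw [H.tgt_comp h₂, pb.tgt_vt]
  | .hcomp a b, ⟨ha, hb, h⟩ => by
    have pa := Raw.WF.isSquare ha
    have pb := Raw.WF.isSquare hb
    have h₁ : V.tgt a.bd.vs = V.src b.bd.vs := by rw [pa.tgt_vs, h, pb.src_vs]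
    have h₂ : V.tgt a.bd.vt = V.src b.bd.vt := by rw [pa.tgt_vt, h, pb.src_vt]
    constructor <;> simp only [Raw.bd]
    · rw [V.src_comp h₁, pa.src_vs]
    · rw [V.tgt_comp h₁, pb.tgt_vs]
    · rw [V.src_comp h₂, pa.src_vt]
    · rw [V.tgt_comp h₂, pb.tgt_vt]
  | .star i a b, ⟨ha, hb, hi, h⟩ => by
    have pa := Raw.WF.isSquare ha
    have pb := Raw.WF.isSquare hb
    obtain ⟨h₁, h₂, h₃⟩ := pa.star pb hi h
    constructor <;> simp only [Raw.bd]
    · rw [V.src_comp_lt hi h₂, H.src_comp_lt hi h, pa.src_vs, pb.src_vs]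
    · rw [V.tgt_comp_lt hi h₂, H.src_comp_lt hi h₁, pa.tgt_vs, pb.tgt_vs]
    · rw [V.src_comp_lt hi h₃, H.tgt_comp_lt hi h, pa.src_vt, pb.src_vt]
    · rw [V.tgt_comp_lt hi h₃, H.tgt_comp_lt hi h₁, pa.tgt_vt, pb.tgt_vt]
  | .inv a e e', ⟨ha, h, h'⟩ => by
    have pa := Raw.WF.isSquare ha
    constructor <;> simp only [Raw.bd]
    · rw [h.1, pa.tgt_vs]
    · rw [h.2.1, pa.src_vs]
    · rw [h'.1, pa.tgt_vt]
    · rw [h'.2.1, pa.src_vt]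

theorem Boundary.ext' {p q : Boundary V H} (h₁ : p.hs = q.hs) (h₂ : p.ht = q.ht)
    (h₃ : p.vs = q.vs) (h₄ : p.vt = q.vt) : p = q := by
  cases p
  cases q
  simp_all

theorem topV {a b : V.Cell} (h : V.tgt a = V.src b) : B.t m (V.tgt a) = B.s m (V.src b) := by
  rw [B.t_top le_rfl, B.s_top le_rfl, h]

theorem id_comp_top (D : ExtCat B) {x : B.Cell} {a : D.Cell} (h : D.src a = x) :
    D.comp m (D.one x) a = a := by
  have := D.id_comp (a := a) le_rfl
  rwa [B.s_top le_rfl, h] at this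

theorem comp_id_top (D : ExtCat B) {x : B.Cell} {a : D.Cell} (h : D.tgt a = x) :
    D.comp m a (D.one x) = a := by
  have := D.comp_id (a := a) le_rfl
  rwa [B.t_top le_rfl, h] at this

theorem id_comp_lt (D : ExtCat B) {i : ℕ} {x : B.Cell} {a : D.Cell} (hi : i < m)
    (h : B.s i (D.src a) = x) : D.comp i (D.one x) a = a := by
  rw [← h, D.id_comp hi.le]

theorem comp_id_lt (D : ExtCat B) {i : ℕ} {x : B.Cell} {a : D.Cell} (hi : i < m)
    (h : B.t i (D.tgt a) = x) : D.comp i a (D.one x) = a := by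
  rw [← h, D.comp_id hi.le]

theorem Ax.bd_eq {a b : Raw Γ} (h : Ax Γ a b) (ha : a.WF) (hb : b.WF) : a.bd = b.bd := by
  cases h with
  | v_assoc a b c =>
    obtain ⟨⟨wa, wb, h1⟩, wc, h2⟩ := ha
    have pa := wa.isSquare
    have pb := wb.isSquare
    have pc := wc.isSquare
    change b.bd.vt = c.bd.vs at h2
    have k1 : H.tgt a.bd.hs = H.src b.bd.hs := by rw [← pa.src_vt, h1, pb.src_vs]
    have k2 : H.tgt a.bd.ht = H.src b.bd.ht := by rw [← pa.tgt_vt, h1, pb.tgt_vs]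
    have k3 : H.tgt b.bd.hs = H.src c.bd.hs := by rw [← pb.src_vt, h2, pc.src_vs]
    have k4 : H.tgt b.bd.ht = H.src c.bd.ht := by rw [← pb.tgt_vt, h2, pc.tgt_vs]
    exact Boundary.ext' (H.assoc le_rfl (topV k1) (topV k3)) (H.assoc le_rfl (topV k2) (topV k4))
      rfl rfl
  | v_id_comp a =>
    have pa := hb.isSquare
    exact Boundary.ext' (id_comp_top H pa.src_vs.symm) (id_comp_top H pa.tgt_vs.symm) rfl rfl
  | v_comp_id a =>
    have pa := hb.isSquare
    exact Boundary.ext' (comp_id_top H pa.src_vt.symm) (comp_id_top H pa.tgt_vt.symm) rfl rfl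
  | h_assoc a b c =>
    obtain ⟨⟨wa, wb, h1⟩, wc, h2⟩ := ha
    have pa := wa.isSquare
    have pb := wb.isSquare
    have pc := wc.isSquare
    change b.bd.ht = c.bd.hs at h2
    have k1 : V.tgt a.bd.vs = V.src b.bd.vs := by rw [pa.tgt_vs, h1, pb.src_vs]
    have k2 : V.tgt a.bd.vt = V.src b.bd.vt := by rw [pa.tgt_vt, h1, pb.src_vt]
    have k3 : V.tgt b.bd.vs = V.src c.bd.vs := by rw [pb.tgt_vs, h2, pc.src_vs]
    have k4 : V.tgt b.bd.vt = V.src c.bd.vt := by rw [pb.tgt_vt, h2, pc.src_vt]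
    exact Boundary.ext' rfl rfl (V.assoc le_rfl (topV k1) (topV k3))
      (V.assoc le_rfl (topV k2) (topV k4))
  | h_id_comp a =>
    have pa := hb.isSquare
    exact Boundary.ext' rfl rfl (id_comp_top V pa.src_vs) (id_comp_top V pa.src_vt)
  | h_comp_id a =>
    have pa := hb.isSquare
    exact Boundary.ext' rfl rfl (comp_id_top V pa.tgt_vs) (comp_id_top V pa.tgt_vt)
  | h_comp_inv a e e' =>
    obtain ⟨wa, ⟨-, i1, i2⟩, -⟩ := ha
    have pa := wa.isSquare
    refine Boundary.ext' rfl rfl ?_ ?_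
    · exact i1.2.2.1.trans (by rw [pa.src_vs]; rfl)
    · exact i2.2.2.1.trans (by rw [pa.src_vt]; rfl)
  | h_inv_comp a e e' =>
    obtain ⟨⟨-, i1, i2⟩, wa, -⟩ := ha
    have pa := wa.isSquare
    refine Boundary.ext' rfl rfl ?_ ?_
    · exact i1.2.2.2.trans (by rw [pa.tgt_vs]; rfl)
    · exact i2.2.2.2.trans (by rw [pa.tgt_vt]; rfl)
  | idv_comp e e' =>
    have h : V.tgt e = V.src e' := by simpa only [Raw.bd, H.src_one] using congrArg H.src hb.2.2
    refine Boundary.ext' ?_ ?_ rfl rfl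
    · simp only [Raw.bd, V.src_comp h]
    · simp only [Raw.bd, V.tgt_comp h]
  | idh_comp f f' =>
    have h : H.tgt f = H.src f' := by simpa only [Raw.bd, V.src_one] using congrArg V.src hb.2.2
    refine Boundary.ext' rfl rfl ?_ ?_
    · simp only [Raw.bd, H.src_comp h]
    · simp only [Raw.bd, H.tgt_comp h]
  | id_one x => simp only [Raw.bd, V.src_one, V.tgt_one, H.src_one, H.tgt_one]
  | interchange a a' b b' => rfl
  | star_assoc i a b c =>
    obtain ⟨⟨wa, wb, hi, h1⟩, wc, -, -⟩ := ha
    obtain ⟨-, ⟨-, -, -, h2⟩, -⟩ := hb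
    obtain ⟨k1, k2, k3⟩ := wa.isSquare.star wb.isSquare hi h1
    obtain ⟨l1, l2, l3⟩ := wb.isSquare.star wc.isSquare hi h2
    exact Boundary.ext' (H.assoc hi.le h1 h2) (H.assoc hi.le k1 l1) (V.assoc hi.le k2 l2)
      (V.assoc hi.le k3 l3)
  | star_id_comp i a =>
    have pa := hb.isSquare
    have hi := ha.2.2.1
    refine Boundary.ext' (id_comp_lt H hi rfl) (id_comp_lt H hi ?_) (id_comp_lt V hi ?_)
      (id_comp_lt V hi ?_)
    · rw [← pa.tgt_vs, ← V.s_src hi, pa.src_vs]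
    · rw [H.src_one, pa.src_vs]
    · rw [H.tgt_one, pa.src_vt, ← H.s_src hi]
  | star_comp_id i a =>
    have pa := hb.isSquare
    have hi := ha.2.2.1
    refine Boundary.ext' (comp_id_lt H hi rfl) (comp_id_lt H hi ?_) (comp_id_lt V hi ?_)
      (comp_id_lt V hi ?_)
    · rw [← pa.tgt_vt, ← V.t_src hi, pa.src_vt]
    · rw [H.src_one, ← V.t_src hi, pa.src_vs, H.t_src hi]
    · rw [H.tgt_one, ← V.t_src hi, pa.src_vt]
  | star_exchange i j a b c d hij =>
    obtain ⟨⟨wa, wb, hj, h1⟩, ⟨wc, wd, -, h2⟩, hi, -⟩ := ha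
    obtain ⟨⟨-, -, -, h3⟩, -⟩ := hb
    obtain ⟨k1, k2, k3⟩ := wa.isSquare.star wb.isSquare hj h1
    obtain ⟨l1, l2, l3⟩ := wc.isSquare.star wd.isSquare hj h2
    obtain ⟨n1, n2, n3⟩ := wa.isSquare.star wc.isSquare hi h3
    exact Boundary.ext' (H.exchange hij hj.le h1 h2 h3) (H.exchange hij hj.le k1 l1 n1)
      (V.exchange hij hj.le k2 l2 n2) (V.exchange hij hj.le k3 l3 n3)
  | star_vcomp i a b c d =>
    obtain ⟨⟨wa, wb, h1⟩, ⟨wc, wd, h2⟩, hi, -⟩ := ha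
    obtain ⟨⟨-, -, -, h3⟩, -⟩ := hb
    have pa := wa.isSquare
    have pb := wb.isSquare
    have pc := wc.isSquare
    have pd := wd.isSquare
    obtain ⟨n1, n2, n3⟩ := pa.star pc hi h3
    have k1 : H.tgt a.bd.hs = H.src b.bd.hs := by rw [← pa.src_vt, h1, pb.src_vs]
    have k2 : H.tgt a.bd.ht = H.src b.bd.ht := by rw [← pa.tgt_vt, h1, pb.tgt_vs]
    have k3 : H.tgt c.bd.hs = H.src d.bd.hs := by rw [← pc.src_vt, h2, pd.src_vs]
    have k4 : H.tgt c.bd.ht = H.src d.bd.ht := by rw [← pc.tgt_vt, h2, pd.tgt_vs]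
    exact Boundary.ext' (H.exchange hi le_rfl (topV k1) (topV k3) h3)
      (H.exchange hi le_rfl (topV k2) (topV k4) n1) rfl rfl
  | star_hcomp i a b c d =>
    obtain ⟨⟨wa, wb, h1⟩, ⟨wc, wd, h2⟩, hi, -⟩ := ha
    obtain ⟨⟨-, -, -, h3⟩, -⟩ := hb
    have pa := wa.isSquare
    have pb := wb.isSquare
    have pc := wc.isSquare
    have pd := wd.isSquare
    obtain ⟨n1, n2, n3⟩ := pa.star pc hi h3
    have k1 : V.tgt a.bd.vs = V.src b.bd.vs := by rw [pa.tgt_vs, h1, pb.src_vs]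
    have k2 : V.tgt a.bd.vt = V.src b.bd.vt := by rw [pa.tgt_vt, h1, pb.src_vt]
    have k3 : V.tgt c.bd.vs = V.src d.bd.vs := by rw [pc.tgt_vs, h2, pd.src_vs]
    have k4 : V.tgt c.bd.vt = V.src d.bd.vt := by rw [pc.tgt_vt, h2, pd.src_vt]
    exact Boundary.ext' rfl rfl (V.exchange hi le_rfl (topV k1) (topV k3) n2)
      (V.exchange hi le_rfl (topV k2) (topV k4) n3)
  | star_idh i f f' =>
    obtain ⟨-, -, hi, h⟩ := hb
    change B.t i (H.tgt f) = B.s i (H.src f') at h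
    refine Boundary.ext' rfl rfl ?_ ?_
    · simp only [Raw.bd]
      rw [H.src_comp_lt hi h, V.one_comp hi (by rw [H.t_src hi, h])]
    · simp only [Raw.bd]
      rw [H.tgt_comp_lt hi h, V.one_comp hi (by rw [h, H.s_src hi])]
  | star_idv i e e' =>
    obtain ⟨-, -, hi, h⟩ := hb
    simp only [Raw.bd, H.tgt_one, H.src_one] at h
    have h' : B.t i (V.tgt e) = B.s i (V.src e') := by rw [← V.t_src hi, h]
    refine Boundary.ext' ?_ ?_ rfl rfl
    · simp only [Raw.bd]
      rw [V.src_comp_lt hi h', H.one_comp hi h]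
    · simp only [Raw.bd]
      rw [V.tgt_comp_lt hi h', H.one_comp hi (by rw [h', V.s_src hi])]

theorem Rel.bd_eq {a b : Raw Γ} (h : Rel Γ a b) : a.bd = b.bd := by
  induction h with
  | refl a => rfl
  | symm _ ih => exact ih.symm
  | trans _ _ ih₁ ih₂ => exact ih₁.trans ih₂
  | vcomp _ _ ih₁ ih₂ => simp only [Raw.bd, ih₁, ih₂]
  | hcomp _ _ ih₁ ih₂ => simp only [Raw.bd, ih₁, ih₂]
  | star i _ _ ih₁ ih₂ => simp only [Raw.bd, ih₁, ih₂]
  | inv e e' _ ih => simp only [Raw.bd, ih]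
  | ax h ha hb => exact h.bd_eq ha hb

end

/-- Well-formed formal pastings, up to the congruence generated by the axioms. -/
def relSetoid (Γ : SquareExt V H) : Setoid {a : Raw Γ // a.WF} where
  r a b := Rel Γ a.1 b.1
  iseqv := ⟨fun _ => .refl _, .symm, .trans⟩

/-- The square cells of the free `m`-category enriched in double categories generated by `Γ`, with
the vertical `(m+1)`-cells of `V` and the horizontal `(m+1)`-cells of `H`, in which the vertical
cells and, for `⋄^h`, the square cells are invertible (here `V` is an `(m+1,m)`-category). -/
def SqCell (Γ : SquareExt V H) : Type u := Quotient Γ.relSetoid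

/-- The boundary of a square cell. -/
def SqCell.bd {Γ : SquareExt V H} (A : SqCell Γ) : Boundary V H :=
  Quotient.lift (s := Γ.relSetoid) (fun a => a.1.bd) (fun _ _ h => Rel.bd_eq h) A

end SquareExt

/-- An `(m+1)`-polygraph modulo `(R, E, S)`.
`R` is an `(m+1)`-polygraph. `E` is an `(m+1)`-polygraph whose generating `k`-cells are those of `R`
for `k < m`, whose set `E_m` of generating `m`-cells is a subset of that of `R`, and whose
generating `(m+1)`-cells `E` form a cellular extension of the free `m`-category on these. Finally
`S` is a cellular extension of the free `m`-category `R_m^*` with `R ⊆ S ⊆ _E R_E`; here `E` is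
seen as a cellular extension of `R_m^*` along the inclusion of polygraphs. -/
structure PolygraphModulo (m : ℕ) where
  R : Polygraph.{u} (m + 1)
  E_m : Set R.trunc.TopGen
  E : CellExt (R.trunc.restrictTop E_m).freeCat
  S : Set (CellExt.modulo R.top (E.push (R.trunc.incl E_m))).Gen
  R_subset_S : ∀ r : R.top.Gen, CellExt.moduloOfGen R.top (E.push (R.trunc.incl E_m)) r ∈ S

namespace PolygraphModulo

variable {m : ℕ} (P : PolygraphModulo.{u} m)

/-- The free `m`-category `R_m^*`. -/
noncomputable abbrev base : NCat.{u} m := P.R.trunc.freeCat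

/-- The modulo rules, as a cellular extension of `R_m^*`. -/
noncomputable abbrev modRules : CellExt P.base := P.E.push (P.R.trunc.incl P.E_m)

/-- The cellular extension `_E R_E`. -/
noncomputable abbrev ERE : CellExt P.base := CellExt.modulo P.R.top P.modRules

/-- The cellular extension `S`. -/
noncomputable abbrev rules : CellExt P.base := P.ERE.restrict P.S

/-- The free `(m+1,m)`-category `E^⊤` over `R_m^*`. -/
noncomputable abbrev Etop : ExtCat P.base := P.modRules.freeInv

/-- The free `(m+1)`-category `S^*` over `R_m^*`. -/
noncomputable abbrev Sstar : ExtCat P.base := P.rules.free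

/-- The `(m+1)`-category `R^*(E)`, generated by `R` and by invertible cells for `E`. -/
noncomputable abbrev RstarE : ExtCat P.base := CellExt.freeMixed P.R.top P.modRules

/-- The canonical functor from `E^⊤` to `R^*(E)`. -/
noncomputable abbrev ofE : P.Etop.Hom P.RstarE := CellExt.mixE P.R.top P.modRules

/-- The canonical functor from `S^*` to `R^*(E)`. -/
noncomputable abbrev ofS : P.Sstar.Hom P.RstarE := CellExt.mixS P.R.top P.modRules P.S

variable (Γ : SquareExt P.Etop P.Sstar)

/-- The data that define an element of `E ⋊ Γ`: a square `A` of `Γ`, with top `f`, bottom `g`, left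
side `e` and right side `e'`, and cells `e₁`, `e₂` of `E^⊤` such that `e₁ ⋆ e ⋆ e₂` is defined and
such that `e₁ ⋆ f` and `e₂⁻ ⋆ g`, which are cells of `R^*(E)`, are cells `top` and `bot`
of `S^*`. -/
structure BiactionData where
  A : Γ.Sq
  e₁ : P.Etop.Cell
  e₂ : P.Etop.Cell
  e₂inv : P.Etop.Cell
  top : P.Sstar.Cell
  bot : P.Sstar.Cell
  tgt_e₁ : P.Etop.tgt e₁ = P.Etop.src (Γ.vs A)
  src_e₂ : P.Etop.src e₂ = P.Etop.tgt (Γ.vs A)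
  isInverse : P.Etop.IsInverse e₂ e₂inv
  top_eq : P.ofS.map top = P.RstarE.comp m (P.ofE.map e₁) (P.ofS.map (Γ.hs A))
  bot_eq : P.ofS.map bot = P.RstarE.comp m (P.ofE.map e₂inv) (P.ofS.map (Γ.ht A))

/-- The square extension `E ⋊ Γ`: its squares have top `e₁ ⋆ f`, bottom `e₂⁻ ⋆ g`, left side
`e₁ ⋆ e ⋆ e₂` and right side `e'`, for a square `A` of `Γ` with top `f`, bottom `g`, left side `e`
and right side `e'`. -/
noncomputable def biaction : SquareExt P.Etop P.Sstar where
  Sq := P.BiactionData Γ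
  hs x := x.top
  ht x := x.bot
  vs x := P.Etop.comp m (P.Etop.comp m x.e₁ (Γ.vs x.A)) x.e₂
  vt x := Γ.vt x.A
  src_vs x := by
    have h : P.RstarE.tgt (P.ofE.map x.e₁) = P.RstarE.src (P.ofS.map (Γ.hs x.A)) := by
      rw [P.ofE.tgt_map, P.ofS.src_map, x.tgt_e₁, Γ.src_vs]
    rw [ExtCat.src_comp _ (by rw [ExtCat.tgt_comp _ x.tgt_e₁, x.src_e₂]),
      ExtCat.src_comp _ x.tgt_e₁, ← P.ofS.src_map x.top, x.top_eq, ExtCat.src_comp _ h,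
      P.ofE.src_map]
  tgt_vs x := by
    have h : P.RstarE.tgt (P.ofE.map x.e₂inv) = P.RstarE.src (P.ofS.map (Γ.ht x.A)) := by
      rw [P.ofE.tgt_map, P.ofS.src_map, x.isInverse.2.1, x.src_e₂, Γ.tgt_vs]
    rw [ExtCat.tgt_comp _ (by rw [ExtCat.tgt_comp _ x.tgt_e₁, x.src_e₂]),
      ← P.ofS.src_map x.bot, x.bot_eq, ExtCat.src_comp _ h, P.ofE.src_map, x.isInverse.1]
  src_vt x := by
    have h : P.RstarE.tgt (P.ofE.map x.e₁) = P.RstarE.src (P.ofS.map (Γ.hs x.A)) := by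
      rw [P.ofE.tgt_map, P.ofS.src_map, x.tgt_e₁, Γ.src_vs]
    rw [Γ.src_vt, ← P.ofS.tgt_map x.top, x.top_eq, ExtCat.tgt_comp _ h, P.ofS.tgt_map]
  tgt_vt x := by
    have h : P.RstarE.tgt (P.ofE.map x.e₂inv) = P.RstarE.src (P.ofS.map (Γ.ht x.A)) := by
      rw [P.ofE.tgt_map, P.ofS.src_map, x.isInverse.2.1, x.src_e₂, Γ.tgt_vs]
    rw [Γ.tgt_vt, ← P.ofS.tgt_map x.bot, x.bot_eq, ExtCat.tgt_comp _ h, P.ofS.tgt_map]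

/-- The square cells of the free `m`-category enriched in double categories, with invertible
vertical cells, generated by `(E, S, E ⋊ Γ ∪ Peiff(E^⊤, S^*))`. -/
abbrev CohSquare : Type u :=
  ((P.biaction Γ).union (SquareExt.peiffer P.Etop P.Sstar)).SqCell

/-- A branching `(f, e, g)` of `S` modulo `E`: `f`, `g` are cells of `S^*`, with `f` not an identity,
and `e` is a cell of `E^⊤` from the source of `f` to the source of `g`. -/
structure Branching where
  f : P.Sstar.Cell
  e : P.Etop.Cell
  g : P.Sstar.Cell
  src_f : P.Sstar.src f = P.Etop.src e
  src_g : P.Sstar.src g = P.Etop.tgt e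
  nontrivial : f ≠ P.Sstar.one (P.Sstar.src f)

variable {P}

/-- The branching `(f, e, g)` is local: `f` has length one, and the lengths of `g` and `e` add up
to one. -/
def Branching.IsLocal (b : P.Branching) : Prop :=
  CellExt.length b.f = 1 ∧ CellExt.length b.g + CellExt.length b.e = 1

variable {Γ}

/-- The branching `(f, e, g)` is `Γ`-confluent modulo `E`: there are cells `f'`, `g'` of `S^*` and
`e'` of `E^⊤`, and a square cell with top `f ⋆ f'`, bottom `g ⋆ g'`, left side `e` and right
side `e'`. -/
def Branching.IsConfluent (Γ : SquareExt P.Etop P.Sstar) (b : P.Branching) : Prop :=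
  ∃ (f' g' : P.Sstar.Cell) (e' : P.Etop.Cell) (A : P.CohSquare Γ),
    P.Sstar.tgt b.f = P.Sstar.src f' ∧ P.Sstar.tgt b.g = P.Sstar.src g' ∧
    P.Sstar.tgt f' = P.Etop.src e' ∧ P.Sstar.tgt g' = P.Etop.tgt e' ∧
    A.bd = ⟨P.Sstar.comp m b.f f', P.Sstar.comp m b.g g', b.e, e'⟩

variable (P)

/-- `S` is locally `Γ`-confluent modulo `E`. -/
def LocallyConfluent (Γ : SquareExt P.Etop P.Sstar) : Prop :=
  ∀ b : P.Branching, b.IsLocal → b.IsConfluent Γ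

/-- `S` is `Γ`-confluent modulo `E`. -/
def Confluent (Γ : SquareExt P.Etop P.Sstar) : Prop :=
  ∀ b : P.Branching, b.IsConfluent Γ

end PolygraphModulo

end Polygr

/-! The statement is strengthened to one about reductions to `S`-normal forms,
`NormalizesCoherently`: for `e : x → y` in `E^⊤`, any reductions `f` of `x` and `g` of `y` to normal
forms are the top and bottom of a square with left side `e`. Every branching then follows: prolong
`f` and `g` to normal forms and fill the square.

The strengthened claim is proved by well-founded induction on `x` for the steps `ModStep` of `R`
modulo `E`. Termination of `_E R_E` makes them well-founded (`Terminating.wellFounded_modStep`), and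
every step of `S` is one of them (`modStep_of_length_eq_one`). A step modulo `E` can absorb any cell
of `E^⊤` in front of it (`ModStep.of_equiv`), so `E`-equivalent cells have the same proper
descendants. The induction hypothesis at `x` is therefore available at every cell `E`-equivalent to
`x`, and induction on the single vertex `x` suffices, instead of on multisets of vertices.

For fixed `x`, the cell `e` is a sequential composite of cells of length at most one (`isChain`).
Reducing each intermediate vertex to some normal form reduces the claim to `length e ≤ 1`, since the
resulting squares can be stacked. If `e` is an identity, this is Newman's argument, started from the
local branching of the two first steps (`normalizes_of_eq_one`). If `length e = 1` and `f` is not an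
identity, the local branching of the first step of `f` against `e` leads back to the identity case
at `y` (`normalizes_of_ne_one`). If only `g` is not an identity, `e` is inverted and the square is
turned over; if both are identities, the identity square on `e` is enough. -/

namespace Polygr

/-! ### Top composition, whiskering and inverses in `(m+1)`-categories. -/

namespace ExtCat

variable {m : ℕ} {B : NCat.{u} m} (D : ExtCat B)

theorem comp_top_of_eq {a b : D.Cell} (h : D.tgt a = D.src b) :
    B.t m (D.tgt a) = B.s m (D.src b) := by
  rw [B.t_top le_rfl, B.s_top le_rfl, h]

theorem assoc_top {a b c : D.Cell} (h₁ : D.tgt a = D.src b) (h₂ : D.tgt b = D.src c) :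
    D.comp m (D.comp m a b) c = D.comp m a (D.comp m b c) :=
  D.assoc le_rfl (D.comp_top_of_eq h₁) (D.comp_top_of_eq h₂)

theorem one_comp_top {x : B.Cell} {a : D.Cell} (h : D.src a = x) : D.comp m (D.one x) a = a :=
  SquareExt.id_comp_top D h

theorem comp_one_top {x : B.Cell} {a : D.Cell} (h : D.tgt a = x) : D.comp m a (D.one x) = a :=
  SquareExt.comp_id_top D h

theorem one_comp_one (x : B.Cell) : D.comp m (D.one x) (D.one x) = D.one x :=
  D.one_comp_top D.src_one

theorem exchange_top {i : ℕ} {a b c d : D.Cell} (hi : i < m) (h₁ : D.tgt a = D.src b)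
    (h₂ : D.tgt c = D.src d) (h₃ : B.t i (D.tgt a) = B.s i (D.src c)) :
    D.comp i (D.comp m a b) (D.comp m c d) = D.comp m (D.comp i a c) (D.comp i b d) :=
  D.exchange hi le_rfl (D.comp_top_of_eq h₁) (D.comp_top_of_eq h₂) h₃

/-- The composite `a ⋆_i b` is `a` whiskered by the source of `b`, followed by `b` whiskered by the
target of `a`. -/
theorem comp_eq_whisker {i : ℕ} {a b : D.Cell} (hi : i < m)
    (h : B.t i (D.tgt a) = B.s i (D.src b)) :
    D.comp i a b = D.comp m (D.comp i a (D.one (D.src b))) (D.comp i (D.one (D.tgt a)) b) := by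
  rw [← D.exchange_top hi D.src_one.symm D.tgt_one (by rw [D.src_one, h]), D.comp_one_top rfl,
    D.one_comp_top rfl]

/-- Whiskering distributes over `⋆_m` by the exchange law, because `1_y = 1_y ⋆_m 1_y`. -/
theorem comp_one_whisker {i : ℕ} {a b : D.Cell} {y : B.Cell} (hi : i < m)
    (h : D.tgt a = D.src b) (hy : B.t i (D.tgt a) = B.s i y) :
    D.comp i (D.comp m a b) (D.one y) =
      D.comp m (D.comp i a (D.one y)) (D.comp i b (D.one y)) := by
  rw [← D.exchange_top hi h (by rw [D.tgt_one, D.src_one]) (by rw [D.src_one, hy]),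
    D.one_comp_one]

theorem one_whisker_comp {i : ℕ} {a b : D.Cell} {y : B.Cell} (hi : i < m)
    (h : D.tgt a = D.src b) (hy : B.t i y = B.s i (D.src a)) :
    D.comp i (D.one y) (D.comp m a b) =
      D.comp m (D.comp i (D.one y) a) (D.comp i (D.one y) b) := by
  rw [← D.exchange_top hi (by rw [D.tgt_one, D.src_one]) h (by rw [D.tgt_one, hy]),
    D.one_comp_one]

variable {D}

theorem IsInverse.symm {a b : D.Cell} (h : D.IsInverse a b) : D.IsInverse b a :=
  ⟨h.2.1.symm, h.1.symm, by rw [h.2.2.2, h.1], by rw [h.2.2.1, h.2.1]⟩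

theorem IsInverse.one (x : B.Cell) : D.IsInverse (D.one x) (D.one x) := by
  simp only [IsInverse, D.src_one, D.tgt_one, D.one_comp_one, and_self]

/-- One half of the inverse law for a composite. The other half is the same identity for the
inverses, taken in the opposite order. -/
theorem IsInverse.comp_eq {a b a' b' : D.Cell} (ha : D.IsInverse a a') (hb : D.IsInverse b b')
    (h : D.tgt a = D.src b) :
    D.comp m (D.comp m a b) (D.comp m b' a') = D.one (D.src a) := by
  have h' : D.tgt b' = D.src a' := by rw [hb.2.1, ha.1, h]
  rw [D.assoc_top h (by rw [D.src_comp h', hb.1]), ← D.assoc_top hb.1.symm h', hb.2.2.1,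
    D.one_comp_top (by rw [ha.1, h]), ha.2.2.1]

theorem IsInverse.comp {a b a' b' : D.Cell} (ha : D.IsInverse a a') (hb : D.IsInverse b b')
    (h : D.tgt a = D.src b) : D.IsInverse (D.comp m a b) (D.comp m b' a') := by
  have h' : D.tgt b' = D.src a' := by rw [hb.2.1, ha.1, h]
  refine ⟨?_, ?_, ?_, ?_⟩
  · rw [D.src_comp h', D.tgt_comp h, hb.1]
  · rw [D.tgt_comp h', D.src_comp h, ha.2.1]
  · rw [ha.comp_eq hb h, D.src_comp h]
  · rw [hb.symm.comp_eq ha.symm h', D.tgt_comp h, hb.1]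

/-- Below the top dimension the order of the factors is kept: the exchange law turns the product
into an `i`-composite of two identities. -/
theorem IsInverse.comp_lt {i : ℕ} {a b a' b' : D.Cell} (ha : D.IsInverse a a')
    (hb : D.IsInverse b b') (hi : i < m) (h : B.t i (D.tgt a) = B.s i (D.src b)) :
    D.IsInverse (D.comp i a b) (D.comp i a' b') := by
  have h₁ : B.t i (D.src a) = B.s i (D.src b) := by rw [D.t_src hi, h]
  have h₂ : B.t i (D.tgt a) = B.s i (D.tgt b) := by rw [h, D.s_src hi]
  have h' : B.t i (D.tgt a') = B.s i (D.src b') := by rw [ha.2.1, hb.1, h₁, D.s_src hi]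
  refine ⟨?_, ?_, ?_, ?_⟩
  · rw [D.src_comp_lt hi h', D.tgt_comp_lt hi h, ha.1, hb.1]
  · rw [D.tgt_comp_lt hi h', D.src_comp_lt hi h, ha.2.1, hb.2.1]
  · rw [← D.exchange_top hi ha.1.symm hb.1.symm h, ha.2.2.1, hb.2.2.1, D.src_comp_lt hi h,
      D.one_comp hi h₁]
  · rw [← D.exchange_top hi ha.2.1 hb.2.1 h', ha.2.2.2, hb.2.2.2, D.tgt_comp_lt hi h,
      D.one_comp hi h₂]

end ExtCat

/-! ### Length, decomposition into steps, and inverses in presented categories. -/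

namespace CellExt

variable {m : ℕ} {B : NCat.{u} m} {Γ : CellExt B} {X : Raw Γ → Raw Γ → Prop}

theorem exists_count_eq_length (x : (present Γ X).Cell) :
    ∃ (a : Raw Γ) (h : a.WF), cls X a h = x ∧ a.count = length x :=
  Nat.sInf_mem (s := {k | ∃ (a : Raw Γ) (h : a.WF), cls X a h = x ∧ a.count = k})
    ⟨_, (Cells.rep x).1, (Cells.rep x).2, cls_rep x, rfl⟩

/-- Induction on the formal composites with the least number of generators. -/
theorem length_induction {p : ℕ → (present Γ X).Cell → Prop} (gen : ∀ γ, p 1 (ofGen X γ))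
    (one : ∀ x, p 0 ((present Γ X).one x))
    (comp : ∀ i k l x y, i ≤ m → B.t i ((present Γ X).tgt x) = B.s i ((present Γ X).src y) →
      p k x → p l y → p (k + l) ((present Γ X).comp i x y))
    (x : (present Γ X).Cell) : p (length x) x := by
  -- The induction runs over all formal composites with their own count, since a subterm of a
  -- composite is easier to control than the length of its class. The minimal representative is
  -- taken only at the end.
  have key : ∀ (a : Raw Γ) (ha : a.WF), p a.count (cls X a ha) := by
    intro a
    induction a with
    | gen γ => exact fun _ => gen γ
    | one x => exact fun _ => one x
    | comp i a b iha ihb =>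
      rintro ⟨ha, hb, hi, h⟩
      have := comp i a.count b.count (cls X a ha) (cls X b hb) hi h (iha ha) (ihb hb)
      have e : (present Γ X).comp i (cls X a ha) (cls X b hb) = cls X (.comp i a b) _ :=
        comp_cls i ha hb ⟨ha, hb, hi, h⟩
      rwa [e] at this
  obtain ⟨a, ha, hx, hc⟩ := exists_count_eq_length x
  have := key a ha
  rwa [hx, hc] at this

theorem length_cls_le (a : Raw Γ) (ha : a.WF) :
    length (cls X a ha : (present Γ X).Cell) ≤ a.count :=
  Nat.sInf_le ⟨a, ha, rfl, rfl⟩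

theorem length_ofGen_le (γ : Γ.Gen) : length (ofGen X γ) ≤ 1 := length_cls_le (.gen γ) trivial

theorem length_one (x : B.Cell) : length ((present Γ X).one x) = 0 :=
  Nat.le_zero.1 (length_cls_le (X := X) (.one x) trivial)

theorem length_comp_le {i : ℕ} {x y : (present Γ X).Cell} (hi : i ≤ m)
    (h : B.t i ((present Γ X).tgt x) = B.s i ((present Γ X).src y)) :
    length ((present Γ X).comp i x y) ≤ length x + length y := by
  obtain ⟨a, ha, rfl, hca⟩ := exists_count_eq_length x
  obtain ⟨b, hb, rfl, hcb⟩ := exists_count_eq_length y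
  rw [← hca, ← hcb]
  have e : (present Γ X).comp i (cls X a ha) (cls X b hb) = cls X (.comp i a b) _ :=
    comp_cls i ha hb ⟨ha, hb, hi, h⟩
  rw [e]
  exact length_cls_le (.comp i a b) _

/-- Lengths add exactly here, whereas relations in a general presentation may shorten a composite:
in a free category every representative has the same count. -/
theorem length_free_comp {i : ℕ} {x y : Γ.free.Cell} (hi : i ≤ m)
    (h : B.t i (Γ.free.tgt x) = B.s i (Γ.free.src y)) :
    length (Γ.free.comp i x y) = length x + length y := by
  induction x using Cells.ind with | _ a ha
  induction y using Cells.ind with | _ b hb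
  have w : (Raw.comp i a b).WF := ⟨ha, hb, hi, h⟩
  exact (congrArg length (comp_cls i ha hb w)).trans ((length_free _ w).trans
    (congrArg₂ (· + ·) (length_free a ha).symm (length_free b hb).symm))

theorem comp_one_one_eq_one {i : ℕ} {x y : (present Γ X).Cell} (hi : i ≤ m)
    (h : B.t i ((present Γ X).tgt x) = B.s i ((present Γ X).src y))
    (hx : x = (present Γ X).one ((present Γ X).src x))
    (hy : y = (present Γ X).one ((present Γ X).src y)) :
    (present Γ X).comp i x y = (present Γ X).one ((present Γ X).src ((present Γ X).comp i x y)) := by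
  generalize (present Γ X).src x = u at hx
  generalize (present Γ X).src y = v at hy
  subst hx hy
  rw [ExtCat.tgt_one, ExtCat.src_one] at h
  rcases hi.lt_or_eq with hi | rfl
  · rw [← ExtCat.one_comp _ hi h, ExtCat.src_one]
  · rw [B.t_top le_rfl, B.s_top le_rfl] at h
    rw [h, ExtCat.one_comp_one, ExtCat.src_one]

/-- A formal composite without generators is built from identities only, and these are closed under
composition. -/
theorem eq_one_of_length_eq_zero (x : (present Γ X).Cell) :
    length x = 0 → x = (present Γ X).one ((present Γ X).src x) := by
  refine length_induction (p := fun k x => k = 0 → x = (present Γ X).one ((present Γ X).src x))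
    (fun _ h => absurd h one_ne_zero) (fun _ _ => by rw [ExtCat.src_one]) ?_ x
  intro i k l x y hi h hx hy hkl
  exact comp_one_one_eq_one hi h (hx (by omega)) (hy (by omega))

/-- The cells that are sequential composites of cells of length at most one. -/
inductive IsChain : (present Γ X).Cell → Prop
  | one (x : B.Cell) : IsChain ((present Γ X).one x)
  | cons {f g : (present Γ X).Cell} (hf : length f ≤ 1)
      (h : (present Γ X).tgt f = (present Γ X).src g) (hg : IsChain g) :
      IsChain ((present Γ X).comp m f g)

theorem IsChain.comp {x y : (present Γ X).Cell} (hx : IsChain x) (hy : IsChain y)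
    (h : (present Γ X).tgt x = (present Γ X).src y) : IsChain ((present Γ X).comp m x y) := by
  induction hx with
  | one x => rwa [ExtCat.one_comp_top _ (by rw [← h, ExtCat.tgt_one])]
  | cons hf hfg _ ih =>
    rw [ExtCat.tgt_comp _ hfg] at h
    rw [ExtCat.assoc_top _ hfg h]
    exact .cons hf (by rw [ExtCat.src_comp _ h, hfg]) (ih h)

/-- Each factor of the chain is whiskered separately; an identity contains no generator, so no
factor exceeds length one. -/
theorem IsChain.comp_one {x : (present Γ X).Cell} (hx : IsChain x) {i : ℕ} (hi : i < m)
    {y : B.Cell} (h : B.t i ((present Γ X).tgt x) = B.s i y) :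
    IsChain ((present Γ X).comp i x ((present Γ X).one y)) := by
  induction hx with
  | one x =>
    rw [ExtCat.tgt_one] at h
    rw [← ExtCat.one_comp _ hi h]
    exact .one _
  | @cons f g hf hfg _ ih =>
    rw [ExtCat.tgt_comp _ hfg] at h
    have h' : B.t i ((present Γ X).tgt f) = B.s i y := by rw [hfg, ExtCat.t_src _ hi, h]
    rw [ExtCat.comp_one_whisker _ hi hfg h']
    refine .cons ((length_comp_le hi.le (by rw [ExtCat.src_one, h'])).trans ?_) ?_ (ih h)
    · rwa [length_one]
    · rw [ExtCat.tgt_comp_lt _ hi (by rw [ExtCat.src_one, h']),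
        ExtCat.src_comp_lt _ hi (by rw [ExtCat.src_one, h]), ExtCat.tgt_one, ExtCat.src_one, hfg]

theorem IsChain.one_comp {x : (present Γ X).Cell} (hx : IsChain x) {i : ℕ} (hi : i < m)
    {y : B.Cell} (h : B.t i y = B.s i ((present Γ X).src x)) :
    IsChain ((present Γ X).comp i ((present Γ X).one y) x) := by
  induction hx with
  | one x =>
    rw [ExtCat.src_one] at h
    rw [← ExtCat.one_comp _ hi h]
    exact .one _
  | @cons f g hf hfg _ ih =>
    rw [ExtCat.src_comp _ hfg] at h
    have h' : B.t i y = B.s i ((present Γ X).src g) := by rw [← hfg, ← ExtCat.s_src _ hi, h]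
    rw [ExtCat.one_whisker_comp _ hi hfg h]
    refine .cons ((length_comp_le hi.le (by rw [ExtCat.tgt_one, h])).trans ?_) ?_ (ih h')
    · rwa [length_one, zero_add]
    · rw [ExtCat.tgt_comp_lt _ hi (by rw [ExtCat.tgt_one, h]),
        ExtCat.src_comp_lt _ hi (by rw [ExtCat.tgt_one, h']), ExtCat.tgt_one, ExtCat.src_one, hfg]

/-- The exchange law makes every `⋆_i` with `i < m` sequential: first the left factor moves, then
the right one, each whiskered by an identity. The bound is `≤ 1` because the relations may shorten a
generator. -/
theorem isChain (x : (present Γ X).Cell) : IsChain x := by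
  refine length_induction (p := fun _ x => IsChain x) (fun γ => ?_) .one ?_ x
  · rw [← (present Γ X).comp_one_top (a := ofGen X γ) rfl]
    exact .cons (length_ofGen_le γ) (ExtCat.src_one _).symm (.one _)
  · intro i _ _ x y hi h cx cy
    rcases hi.lt_or_eq with hi | rfl
    · rw [ExtCat.comp_eq_whisker _ hi h]
      refine (cx.comp_one hi h).comp (cy.one_comp hi h) ?_
      rw [ExtCat.tgt_comp_lt _ hi (by rw [ExtCat.src_one, h]),
        ExtCat.src_comp_lt _ hi (by rw [ExtCat.tgt_one, h]), ExtCat.tgt_one, ExtCat.src_one]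
    · exact cx.comp cy (ExtCat.comp_top _ h)

/-- A cell of a free `(m+1)`-category is an identity, or a step followed by a cell. -/
theorem free_eq_one_or_eq_step_comp (x : Γ.free.Cell) :
    x = Γ.free.one (Γ.free.src x) ∨ ∃ f g : Γ.free.Cell, length f = 1 ∧
      Γ.free.tgt f = Γ.free.src g ∧ x = Γ.free.comp m f g := by
  have hx : IsChain (Γ := Γ) (X := Γ.noRel) x := isChain x
  induction hx with
  | one x => exact .inl rfl
  | @cons f g hf h hg ih =>
    rcases Nat.le_one_iff_eq_zero_or_eq_one.1 hf with hf | hf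
    · have e : (present Γ Γ.noRel).comp m f g = g := by
        have := eq_one_of_length_eq_zero _ hf
        rw [this] at h ⊢
        rw [ExtCat.tgt_one] at h
        exact ExtCat.one_comp_top _ h.symm
      rw [e]
      exact ih
    · exact .inr ⟨f, g, hf, h, rfl⟩

theorem isInverse_ofGen (γ : Γ.Gen) : Γ.freeInv.IsInverse
    (ofGen (InvRel (ι := Γ.Gen) (Γ.add Γ.op) Sum.inl Sum.inr) (.inl γ)) (ofGen _ (.inr γ)) := by
  have w : (Raw.comp m (.gen (.inl γ)) (.gen (.inr γ)) : Raw (Γ.add Γ.op)).WF :=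
    ⟨trivial, trivial, le_rfl, by rw [B.t_top le_rfl, B.s_top le_rfl]; rfl⟩
  have w' : (Raw.comp m (.gen (.inr γ)) (.gen (.inl γ)) : Raw (Γ.add Γ.op)).WF :=
    ⟨trivial, trivial, le_rfl, by rw [B.t_top le_rfl, B.s_top le_rfl]; rfl⟩
  refine ⟨rfl, rfl, ?_, ?_⟩
  · refine (comp_cls m (a := .gen _) (b := .gen _) trivial trivial w).trans ?_
    exact cls_eq (b := .one (Γ.src γ)) (.rel (.left γ) w trivial (by simp [Raw.src, add])
      (by simp [Raw.tgt, add, op]))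
  · refine (comp_cls m (a := .gen _) (b := .gen _) trivial trivial w').trans ?_
    exact cls_eq (b := .one (Γ.tgt γ)) (.rel (.right γ) w' trivial (by simp [Raw.src, add, op])
      (by simp [Raw.tgt, add]))

/-- Every cell of a free `(m+1,m)`-category has an inverse which is not longer. -/
theorem exists_isInverse (x : Γ.freeInv.Cell) :
    ∃ y : Γ.freeInv.Cell, Γ.freeInv.IsInverse x y ∧ length y ≤ length x := by
  refine length_induction (p := fun k x => ∃ y : Γ.freeInv.Cell,
    Γ.freeInv.IsInverse x y ∧ length y ≤ k) ?_ ?_ ?_ x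
  · rintro (γ | γ)
    · exact ⟨_, isInverse_ofGen γ, length_ofGen_le _⟩
    · exact ⟨_, (isInverse_ofGen (Γ := Γ) γ).symm, length_ofGen_le _⟩
  · exact fun x => ⟨_, .one x, (length_one x).le⟩
  · rintro i k l x y hi h ⟨x', ix, lx⟩ ⟨y', iy, ly⟩
    -- The inverse of an `i`-composite is the `i`-composite of the inverses for `i < m`, and
    -- reverses the order for `i = m`. Neither form is longer than the sum of the two bounds.
    rcases hi.lt_or_eq with him | rfl
    · refine ⟨_, ix.comp_lt iy him h, (length_comp_le hi ?_).trans (Nat.add_le_add lx ly)⟩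
      have h₁ := ix.2.1
      have h₂ := iy.1
      have h₃ := Γ.freeInv.t_src (a := x) him
      have h₄ := Γ.freeInv.s_src (a := y) him
      exact (congrArg (B.t i) h₁).trans (h₃.trans (h.trans (h₄.trans (congrArg (B.s i) h₂.symm))))
    · have h' := ExtCat.comp_top _ h
      refine ⟨_, ix.comp iy h', (length_comp_le hi ?_).trans ?_⟩
      · exact ExtCat.comp_top_of_eq _ (iy.2.1.trans (h'.symm.trans ix.1.symm))
      · exact (Nat.add_le_add ly lx).trans (Nat.add_comm _ _).le

end CellExt

/-! ### Rewriting steps modulo `E` and their well-foundedness. -/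

namespace CellExt

variable {m : ℕ} {B : NCat.{u} m} (R E : CellExt B)

/-- There is a rewriting step of `R` modulo `E` from `u` to `v`. -/
def ModStep (u v : B.Cell) : Prop :=
  ∃ (e : E.freeInv.Cell) (f : R.free.Cell) (e' : E.freeInv.Cell), length f = 1 ∧
    E.freeInv.tgt e = R.free.src f ∧ R.free.tgt f = E.freeInv.src e' ∧
    E.freeInv.src e = u ∧ E.freeInv.tgt e' = v

variable {R E}

/-- The three components are whiskered one by one. The middle one keeps exactly one generator, since
lengths add in `R^*`. -/
theorem ModStep.comp_one {u v : B.Cell} (h : ModStep R E u v) {i : ℕ} (hi : i < m) {y : B.Cell}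
    (hy : B.t i u = B.s i y) : ModStep R E (B.comp i u y) (B.comp i v y) := by
  obtain ⟨e, f, e', hf, h₁, h₂, rfl, rfl⟩ := h
  have c₁ : B.t i (E.freeInv.tgt e) = B.s i (E.freeInv.src (E.freeInv.one y)) := by
    rw [← ExtCat.t_src _ hi, hy, ExtCat.src_one]
  have c₂ : B.t i (R.free.tgt f) = B.s i (R.free.src (R.free.one y)) := by
    rw [← ExtCat.t_src _ hi, ← h₁, ← ExtCat.t_src _ hi, hy, ExtCat.src_one]
  have c₃ : B.t i (E.freeInv.tgt e') = B.s i (E.freeInv.src (E.freeInv.one y)) := by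
    rw [← ExtCat.t_src _ hi, ← h₂, c₂, ExtCat.src_one, ExtCat.src_one]
  refine ⟨E.freeInv.comp i e (E.freeInv.one y), R.free.comp i f (R.free.one y),
    E.freeInv.comp i e' (E.freeInv.one y), ?_, ?_, ?_, ?_, ?_⟩
  · rw [length_free_comp hi.le c₂, hf]
    exact congrArg (1 + ·) (length_one (X := R.noRel) y)
  · rw [ExtCat.tgt_comp_lt _ hi c₁, ExtCat.src_comp_lt _ hi c₂, h₁, ExtCat.tgt_one, ExtCat.src_one]
  · rw [ExtCat.tgt_comp_lt _ hi c₂, ExtCat.src_comp_lt _ hi c₃, h₂, ExtCat.tgt_one, ExtCat.src_one]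
  · rw [ExtCat.src_comp_lt _ hi c₁, ExtCat.src_one]
  · rw [ExtCat.tgt_comp_lt _ hi c₃, ExtCat.tgt_one]

theorem ModStep.one_comp {u v : B.Cell} (h : ModStep R E u v) {i : ℕ} (hi : i < m) {y : B.Cell}
    (hy : B.t i y = B.s i u) : ModStep R E (B.comp i y u) (B.comp i y v) := by
  obtain ⟨e, f, e', hf, h₁, h₂, rfl, rfl⟩ := h
  have c₁ : B.t i (E.freeInv.tgt (E.freeInv.one y)) = B.s i (E.freeInv.src e) := by
    rw [ExtCat.tgt_one, hy]
  have c₂ : B.t i (R.free.tgt (R.free.one y)) = B.s i (R.free.src f) := by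
    rw [ExtCat.tgt_one, hy, ExtCat.s_src _ hi, h₁]
  have c₃ : B.t i (E.freeInv.tgt (E.freeInv.one y)) = B.s i (E.freeInv.src e') := by
    rw [ExtCat.tgt_one, hy, ExtCat.s_src _ hi, h₁, ExtCat.s_src _ hi, h₂]
  refine ⟨E.freeInv.comp i (E.freeInv.one y) e, R.free.comp i (R.free.one y) f,
    E.freeInv.comp i (E.freeInv.one y) e', ?_, ?_, ?_, ?_, ?_⟩
  · rw [length_free_comp hi.le c₂, hf]
    exact congrArg (· + 1) (length_one (X := R.noRel) y)
  · rw [ExtCat.tgt_comp_lt _ hi c₁, ExtCat.src_comp_lt _ hi c₂, h₁, ExtCat.tgt_one, ExtCat.src_one]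
  · rw [ExtCat.tgt_comp_lt _ hi c₂, ExtCat.src_comp_lt _ hi c₃, h₂, ExtCat.tgt_one, ExtCat.src_one]
  · rw [ExtCat.src_comp_lt _ hi c₁, ExtCat.src_one]
  · rw [ExtCat.tgt_comp_lt _ hi c₃, ExtCat.tgt_one]

/-- The cell `e` is absorbed into the left `E`-component of the triple. This is where steps modulo
`E` behave better than steps of `S`, which need not be stable under `E`. -/
theorem ModStep.of_equiv {e : E.freeInv.Cell} {v : B.Cell}
    (h : ModStep R E (E.freeInv.tgt e) v) : ModStep R E (E.freeInv.src e) v := by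
  obtain ⟨e₁, f, e', hf, h₁, h₂, h₃, rfl⟩ := h
  exact ⟨E.freeInv.comp m e e₁, f, e', hf, by rw [ExtCat.tgt_comp _ h₃.symm, h₁], h₂,
    ExtCat.src_comp _ h₃.symm, rfl⟩

/-- A rewriting step of `S ⊆ _E R_E` is a rewriting step of `R` modulo `E`. -/
theorem modStep_of_length_eq_one {S : Set (modulo R E).Gen}
    (x : ((modulo R E).restrict S).free.Cell) :
    length x = 1 → ModStep R E (((modulo R E).restrict S).free.src x)
      (((modulo R E).restrict S).free.tgt x) := by
  set D := present ((modulo R E).restrict S) (noRel _) with hD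
  -- The claim for count zero is carried along: in a composite of count one, one factor has count
  -- one and the other must be known to be an identity.
  have key := length_induction (Γ := (modulo R E).restrict S) (X := noRel _)
    (p := fun k x => (k = 0 → x = D.one (D.src x)) ∧ (k = 1 → ModStep R E (D.src x) (D.tgt x)))
    ?_ ?_ ?_ x
  · exact key.2
  · exact fun γ => ⟨fun h => absurd h one_ne_zero, fun _ =>
      ⟨γ.1.1.1, γ.1.1.2.1, γ.1.1.2.2, γ.1.2.1, γ.1.2.2.1, γ.1.2.2.2, rfl, rfl⟩⟩
  · exact fun x => ⟨fun _ => by rw [ExtCat.src_one], fun h => absurd h zero_ne_one⟩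
  · rintro i k l x y hi h ⟨hx₀, hx₁⟩ ⟨hy₀, hy₁⟩
    refine ⟨fun hkl => comp_one_one_eq_one hi h (hx₀ (by omega)) (hy₀ (by omega)), fun hkl => ?_⟩
    have hkl : (k = 1 ∧ l = 0) ∨ (k = 0 ∧ l = 1) := by omega
    rcases hkl with ⟨hk, hl⟩ | ⟨hk, hl⟩
    · have hx := hx₁ hk
      have hy := hy₀ hl
      generalize D.src y = v at hy
      subst hy
      rw [ExtCat.src_one] at h
      -- Composing with an identity is a whiskering for `i < m`, and does nothing for `i = m`.
      rcases hi.lt_or_eq with hi | rfl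
      · rw [ExtCat.src_comp_lt _ hi (by rw [ExtCat.src_one, h]),
          ExtCat.tgt_comp_lt _ hi (by rw [ExtCat.src_one, h]), ExtCat.src_one, ExtCat.tgt_one]
        exact hx.comp_one hi (by rw [ExtCat.t_src _ hi, h])
      · rw [B.t_top le_rfl, B.s_top le_rfl] at h
        rwa [ExtCat.comp_one_top _ h]
    · have hx := hx₀ hk
      have hy := hy₁ hl
      generalize D.src x = v at hx
      subst hx
      rw [ExtCat.tgt_one] at h
      rcases hi.lt_or_eq with hi | rfl
      · rw [ExtCat.src_comp_lt _ hi (by rw [ExtCat.tgt_one, h]),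
          ExtCat.tgt_comp_lt _ hi (by rw [ExtCat.tgt_one, h]), ExtCat.src_one, ExtCat.tgt_one]
        exact hy.one_comp hi h
      · rw [B.t_top le_rfl, B.s_top le_rfl] at h
        rwa [ExtCat.one_comp_top _ h.symm]

/-- Each triple is itself a generator of `_E R_E`, hence a cell of length one, so an infinite
descending chain would be an infinite rewriting sequence. -/
theorem Terminating.wellFounded_modStep (h : (modulo R E).Terminating) :
    WellFounded fun v u => ModStep R E u v := by
  rw [wellFounded_iff_isEmpty_descending_chain]
  refine ⟨fun ⟨u, hu⟩ => h ⟨u, fun k => ?_⟩⟩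
  obtain ⟨e, f, e', hf, h₁, h₂, h₃, h₄⟩ := hu k
  exact ⟨ofGen _ ⟨(e, f, e'), hf, h₁, h₂⟩, length_free (.gen _) trivial, h₃, h₄⟩

end CellExt

/-! ### Existence of squares with a given boundary, and their pasting. -/

namespace SquareExt

variable {m : ℕ} {B : NCat.{u} m} {V H : ExtCat B}

/-- There is a square cell with top `f`, bottom `g`, left side `e` and right side `e'`. -/
def HasSquare (Γ : SquareExt V H) (f g : H.Cell) (e e' : V.Cell) : Prop :=
  ∃ A : Γ.SqCell, A.bd = ⟨f, g, e, e'⟩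

variable {Γ : SquareExt V H}

/-- Confluence depends only on boundaries, so formal pastings may replace their classes, and squares
are built without any use of the axioms of double categories. -/
theorem hasSquare_iff {f g : H.Cell} {e e' : V.Cell} :
    Γ.HasSquare f g e e' ↔ ∃ a : Raw Γ, a.WF ∧ a.bd = ⟨f, g, e, e'⟩ := by
  constructor
  · rintro ⟨A, hA⟩
    induction A using Quotient.ind with | _ a
    exact ⟨a.1, a.2, hA⟩
  · rintro ⟨a, ha, h⟩
    exact ⟨Quotient.mk Γ.relSetoid ⟨a, ha⟩, h⟩

theorem HasSquare.isSquare {f g : H.Cell} {e e' : V.Cell} (h : Γ.HasSquare f g e e') :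
    Boundary.IsSquare ⟨f, g, e, e'⟩ := by
  obtain ⟨a, ha, h⟩ := hasSquare_iff.1 h
  rw [← h]
  exact ha.isSquare

theorem hasSquare_idh (f : H.Cell) : Γ.HasSquare f f (V.one (H.src f)) (V.one (H.tgt f)) :=
  hasSquare_iff.2 ⟨.idh f, trivial, rfl⟩

theorem hasSquare_idv (e : V.Cell) : Γ.HasSquare (H.one (V.src e)) (H.one (V.tgt e)) e e :=
  hasSquare_iff.2 ⟨.idv e, trivial, rfl⟩

theorem HasSquare.vcomp {f g f' g' : H.Cell} {e e' e'' : V.Cell} (h : Γ.HasSquare f g e e')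
    (h' : Γ.HasSquare f' g' e' e'') :
    Γ.HasSquare (H.comp m f f') (H.comp m g g') e e'' := by
  obtain ⟨a, ha, h⟩ := hasSquare_iff.1 h
  obtain ⟨b, hb, h'⟩ := hasSquare_iff.1 h'
  exact hasSquare_iff.2 ⟨.vcomp a b, ⟨ha, hb, by rw [h, h']⟩, by simp only [Raw.bd, h, h']⟩

theorem HasSquare.hcomp {f g k : H.Cell} {e e' d d' : V.Cell} (h : Γ.HasSquare f g e e')
    (h' : Γ.HasSquare g k d d') : Γ.HasSquare f k (V.comp m e d) (V.comp m e' d') := by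
  obtain ⟨a, ha, h⟩ := hasSquare_iff.1 h
  obtain ⟨b, hb, h'⟩ := hasSquare_iff.1 h'
  exact hasSquare_iff.2 ⟨.hcomp a b, ⟨ha, hb, by rw [h, h']⟩, by simp only [Raw.bd, h, h']⟩

theorem HasSquare.inv {f g : H.Cell} {e e' d d' : V.Cell} (h : Γ.HasSquare f g e e')
    (hd : V.IsInverse e d) (hd' : V.IsInverse e' d') : Γ.HasSquare g f d d' := by
  obtain ⟨a, ha, h⟩ := hasSquare_iff.1 h
  exact hasSquare_iff.2 ⟨.inv a d d', ⟨ha, by rwa [h], by rwa [h]⟩, by simp only [Raw.bd, h]⟩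

/-- A square with an identity on the left can be extended to the left by a horizontal cell. -/
theorem HasSquare.one_vcomp {f g k : H.Cell} {x : B.Cell} {e : V.Cell}
    (h : Γ.HasSquare f g (V.one x) e) (hk : H.tgt k = x) :
    Γ.HasSquare (H.comp m k f) (H.comp m k g) (V.one (H.src k)) e :=
  (hasSquare_idh k).vcomp (hk ▸ h)

/-- Serves to replace the top of a square by another reduction from the same source without changing
the left side. `HasSquare.hcomp_one` does the same for the bottom. -/
theorem HasSquare.one_hcomp {f g k : H.Cell} {x : B.Cell} {e d d' : V.Cell}
    (h : Γ.HasSquare f g (V.one x) e) (h' : Γ.HasSquare g k d d') :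
    Γ.HasSquare f k d (V.comp m e d') := by
  have h₁ := h.isSquare.tgt_vs.trans h'.isSquare.src_vs.symm
  rw [V.tgt_one] at h₁
  have := h.hcomp h'
  rwa [V.one_comp_top h₁.symm] at this

theorem HasSquare.hcomp_one {f g k : H.Cell} {x : B.Cell} {e d d' : V.Cell}
    (h : Γ.HasSquare f g d d') (h' : Γ.HasSquare g k (V.one x) e) :
    Γ.HasSquare f k d (V.comp m d' e) := by
  have h₁ := h.isSquare.tgt_vs.trans h'.isSquare.src_vs.symm
  rw [V.src_one] at h₁
  have := h.hcomp h'
  rwa [V.comp_one_top h₁] at this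

end SquareExt

/-! ### Newman's argument: coherence of reductions to normal forms. -/

namespace PolygraphModulo

open CellExt Relation

variable {m : ℕ} {P : PolygraphModulo.{u} m} {Γ : SquareExt P.Etop P.Sstar}

variable (P Γ) in
/-- There is a square cell generated by `E ⋊ Γ` and the Peiffer squares with the given sides. -/
def HasCohSquare (f g : P.Sstar.Cell) (e e' : P.Etop.Cell) : Prop :=
  ((P.biaction Γ).union (SquareExt.peiffer P.Etop P.Sstar)).HasSquare f g e e'

variable (P) in
/-- The relation on `m`-cells given by the rewriting steps modulo `E`. -/
def Step (u v : P.base.Cell) : Prop := ModStep P.R.top P.modRules u v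

variable (P) in
/-- No rewriting step of `S` applies to `u`. -/
def IsNormal (u : P.base.Cell) : Prop :=
  ∀ f : P.Sstar.Cell, P.Sstar.src f = u → f = P.Sstar.one u

theorem step_of_length_eq_one {f : P.Sstar.Cell} (hf : length f = 1) :
    P.Step (P.Sstar.src f) (P.Sstar.tgt f) :=
  modStep_of_length_eq_one f hf

theorem eq_one_or_eq_step_comp (f : P.Sstar.Cell) :
    f = P.Sstar.one (P.Sstar.src f) ∨ ∃ f₁ f₂ : P.Sstar.Cell, length f₁ = 1 ∧
      P.Sstar.tgt f₁ = P.Sstar.src f₂ ∧ f = P.Sstar.comp m f₁ f₂ :=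
  free_eq_one_or_eq_step_comp f

theorem reflTransGen_step (f : P.Sstar.Cell) :
    ReflTransGen P.Step (P.Sstar.src f) (P.Sstar.tgt f) := by
  have hf : IsChain (Γ := P.rules) (X := noRel _) f := isChain f
  induction hf with
  | one x => exact .refl
  | @cons f g hf h hg ih =>
    have ih : ReflTransGen P.Step (P.Sstar.src g) (P.Sstar.tgt g) := ih
    have h : P.Sstar.tgt f = P.Sstar.src g := h
    change ReflTransGen P.Step (P.Sstar.src (P.Sstar.comp m f g)) (P.Sstar.tgt (P.Sstar.comp m f g))
    rw [ExtCat.src_comp _ h, ExtCat.tgt_comp _ h]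
    rcases Nat.le_one_iff_eq_zero_or_eq_one.1 hf with hf | hf
    · have e : f = P.Sstar.one (P.Sstar.src f) := eq_one_of_length_eq_zero _ hf
      rwa [e, ExtCat.src_one, ← ExtCat.tgt_one P.Sstar (x := P.Sstar.src f), ← e, h]
    · exact .head (step_of_length_eq_one hf) (h ▸ ih)

/-- Only the first step of the path has to absorb `e`. This transports the induction hypothesis
along `E^⊤`. -/
theorem transGen_step_of_equiv (e : P.Etop.Cell) {v : P.base.Cell}
    (h : TransGen P.Step (P.Etop.tgt e) v) : TransGen P.Step (P.Etop.src e) v := by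
  obtain ⟨w, h₁, h₂⟩ := TransGen.head'_iff.1 h
  exact TransGen.head'_iff.2 ⟨w, ModStep.of_equiv h₁, h₂⟩

/-- A non-identity cell of `S^*` begins with a step of `S`, which strictly decreases the source for
the steps modulo `E`. -/
theorem exists_isNormal (hwf : WellFounded fun v u => P.Step u v) (u : P.base.Cell) :
    ∃ f : P.Sstar.Cell, P.Sstar.src f = u ∧ P.IsNormal (P.Sstar.tgt f) := by
  induction u using hwf.induction with | _ u ih
  by_cases hu : P.IsNormal u
  · exact ⟨P.Sstar.one u, ExtCat.src_one _, by rwa [ExtCat.tgt_one]⟩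
  · simp only [IsNormal, not_forall] at hu
    obtain ⟨f, rfl, hf⟩ := hu
    rcases eq_one_or_eq_step_comp f with h | ⟨f₁, f₂, h₁, h₂, rfl⟩
    · exact absurd h hf
    · rw [ExtCat.src_comp _ h₂] at ih ⊢
      obtain ⟨g, hg, hn⟩ := ih _ (step_of_length_eq_one h₁)
      exact ⟨P.Sstar.comp m f₁ g, ExtCat.src_comp _ hg.symm, by rwa [ExtCat.tgt_comp _ hg.symm]⟩

variable (P Γ) in
/-- Any two reductions to normal forms from two `E`-equivalent `m`-cells, the first of which is `x`,
bound a square cell. -/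
def NormalizesCoherently (x : P.base.Cell) : Prop :=
  ∀ (e : P.Etop.Cell) (f g : P.Sstar.Cell), P.Etop.src e = x → P.Sstar.src f = x →
    P.Sstar.src g = P.Etop.tgt e → P.IsNormal (P.Sstar.tgt f) → P.IsNormal (P.Sstar.tgt g) →
    ∃ e', P.HasCohSquare Γ f g e e'

/-- Local confluence in the form used below. A cell of length one is not an identity, so the data do
form a branching. -/
theorem LocallyConfluent.exists_square (hloc : P.LocallyConfluent Γ) {f g : P.Sstar.Cell}
    {e : P.Etop.Cell} (hf : P.Sstar.src f = P.Etop.src e) (hg : P.Sstar.src g = P.Etop.tgt e)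
    (h₁ : length f = 1) (h₂ : length g + length e = 1) :
    ∃ f' g' e', P.Sstar.tgt f = P.Sstar.src f' ∧ P.Sstar.tgt g = P.Sstar.src g' ∧
      P.HasCohSquare Γ (P.Sstar.comp m f f') (P.Sstar.comp m g g') e e' := by
  have hne : f ≠ P.Sstar.one (P.Sstar.src f) := fun h => by
    have h₀ : length (P.Sstar.one (P.Sstar.src f)) = 0 := length_one _
    rw [← h, h₁] at h₀
    exact one_ne_zero h₀
  obtain ⟨f', g', e', A, t₁, t₂, -, -, hA⟩ := hloc ⟨f, e, g, hf, hg, hne⟩ ⟨h₁, h₂⟩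
  exact ⟨f', g', e', t₁, t₂, A, hA⟩

/-- A square whose top starts with the first step of a reduction to a normal form can be extended
to a square whose top is this reduction. -/
theorem exists_square_of_first_step (hwf : WellFounded fun v u => P.Step u v)
    {f₁ f₂ f' g' : P.Sstar.Cell} {e e₁ : P.Etop.Cell}
    (ih : ∀ z, TransGen P.Step (P.Sstar.src f₁) z → P.NormalizesCoherently Γ z)
    (h₁ : length f₁ = 1) (h₂ : P.Sstar.tgt f₁ = P.Sstar.src f₂)
    (hn : P.IsNormal (P.Sstar.tgt f₂)) (h' : P.Sstar.tgt f₁ = P.Sstar.src f')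
    (hL : P.HasCohSquare Γ (P.Sstar.comp m f₁ f') g' e e₁) :
    ∃ k e', P.Sstar.tgt g' = P.Sstar.src k ∧ P.IsNormal (P.Sstar.tgt k) ∧
      P.HasCohSquare Γ (P.Sstar.comp m f₁ f₂) (P.Sstar.comp m g' k) e e' := by
  have q := hL.isSquare
  have hs : P.Etop.src e₁ = P.Sstar.tgt f' := q.src_vt.trans (ExtCat.tgt_comp _ h')
  have ht : P.Etop.tgt e₁ = P.Sstar.tgt g' := q.tgt_vt
  have hstep := step_of_length_eq_one h₁
  -- The two corners on the right of the given square are continued to normal forms.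
  obtain ⟨h, hh, nh⟩ := exists_isNormal hwf (P.Sstar.tgt f')
  obtain ⟨k, hk, nk⟩ := exists_isNormal hwf (P.Sstar.tgt g')
  -- Both `f₂` and `f' ⋆ h` normalize the target of `f₁`, one step below the source, so they are
  -- compared over an identity.
  obtain ⟨a, ha⟩ := ih _ (.single hstep) (P.Etop.one (P.Sstar.tgt f₁)) f₂ (P.Sstar.comp m f' h)
    (ExtCat.src_one _) h₂.symm (by rw [ExtCat.src_comp _ hh.symm, ExtCat.tgt_one, h']) hn
    (by rwa [ExtCat.tgt_comp _ hh.symm])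
  -- The source of `e₁` lies below the starting vertex by `f₁` and then `f'`, possibly many steps
  -- down. Here `e₁` is arbitrary, which is why the induction hypothesis ranges over all cells of
  -- `E^⊤`.
  obtain ⟨b, hb⟩ := ih (P.Sstar.tgt f') (TransGen.head' hstep (h' ▸ reflTransGen_step f')) e₁ h k
    hs hh (hk.trans ht.symm) nh nk
  -- The upper row changes `f₁ ⋆ f₂` into `f₁ ⋆ f' ⋆ h` over an identity; the lower row is the given
  -- square followed on its right by the comparison of `h` with `k`.
  refine ⟨k, P.Etop.comp m a b, hk.symm, nk, (ha.one_vcomp rfl).one_hcomp ?_⟩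
  rw [← ExtCat.assoc_top _ h' hh.symm]
  exact hL.vcomp hb

/-- The usual proof of Newman's lemma, with each comparison recorded by a square. The right side
need not be an identity, since normal forms are reached only up to `E`. -/
theorem normalizes_of_eq_one (hwf : WellFounded fun v u => P.Step u v)
    (hloc : P.LocallyConfluent Γ) {x : P.base.Cell}
    (ih : ∀ z, TransGen P.Step x z → P.NormalizesCoherently Γ z) {f g : P.Sstar.Cell}
    (hf : P.Sstar.src f = x) (hg : P.Sstar.src g = x) (nf : P.IsNormal (P.Sstar.tgt f))
    (ng : P.IsNormal (P.Sstar.tgt g)) : ∃ e', P.HasCohSquare Γ f g (P.Etop.one x) e' := by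
  by_cases hfg : f = g
  · subst hfg hf
    exact ⟨_, SquareExt.hasSquare_idh f⟩
  -- If one of the reductions is an identity, then `x` is normal and the other is the same identity,
  -- a case already excluded.
  rcases eq_one_or_eq_step_comp f with h | ⟨f₁, f₂, h₁, h₂, rfl⟩
  · rw [h, ExtCat.tgt_one, hf] at nf
    exact absurd (h.trans (by rw [hf, nf g hg])) hfg
  rcases eq_one_or_eq_step_comp g with h | ⟨g₁, g₂, k₁, k₂, rfl⟩
  · rw [h, ExtCat.tgt_one, hg] at ng
    exact absurd ((ng _ hf).trans (by rw [h, hg])) hfg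
  rw [ExtCat.src_comp _ h₂] at hf
  rw [ExtCat.src_comp _ k₂] at hg
  rw [ExtCat.tgt_comp _ h₂] at nf
  rw [ExtCat.tgt_comp _ k₂] at ng
  subst hf
  have l₁ : length (P.Etop.one (P.Sstar.src f₁)) = 0 := length_one _
  obtain ⟨f', g', e₁, t₁, t₂, hL⟩ := hloc.exists_square (f := f₁) (g := g₁)
    (e := P.Etop.one (P.Sstar.src f₁)) (ExtCat.src_one _).symm (by rw [ExtCat.tgt_one, hg]) h₁
    (by rw [k₁, l₁])
  obtain ⟨k, b, hk, nk, hb⟩ := exists_square_of_first_step hwf ih h₁ h₂ nf t₁ hL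
  rw [ExtCat.tgt_comp _ t₂] at hk
  rw [ExtCat.assoc_top _ t₂ hk] at hb
  -- The bottom obtained so far is `g₁` followed by `g' ⋆ k`. It remains to exchange `g' ⋆ k` for
  -- `g₂`, both of which normalize the target of `g₁`.
  obtain ⟨c, hc⟩ := ih (P.Sstar.tgt g₁) (hg ▸ .single (step_of_length_eq_one k₁))
    (P.Etop.one (P.Sstar.tgt g₁)) (P.Sstar.comp m g' k) g₂ (ExtCat.src_one _)
    (by rw [ExtCat.src_comp _ hk, t₂]) (by rw [ExtCat.tgt_one, k₂])
    (by rwa [ExtCat.tgt_comp _ hk]) ng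
  exact ⟨_, hb.hcomp_one (hc.one_vcomp rfl)⟩

/-- The first step of the top makes a local branching against `e`. After that the two bottoms start
at the same vertex, so only Newman's argument at the target of `e` is left. -/
theorem normalizes_of_ne_one (hwf : WellFounded fun v u => P.Step u v)
    (hloc : P.LocallyConfluent Γ) {e : P.Etop.Cell}
    (ih : ∀ z, TransGen P.Step (P.Etop.src e) z → P.NormalizesCoherently Γ z)
    (ih' : ∀ z, TransGen P.Step (P.Etop.tgt e) z → P.NormalizesCoherently Γ z)
    (he : length e = 1) {f g : P.Sstar.Cell} (hf : P.Sstar.src f = P.Etop.src e)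
    (hg : P.Sstar.src g = P.Etop.tgt e) (nf : P.IsNormal (P.Sstar.tgt f))
    (ng : P.IsNormal (P.Sstar.tgt g)) (hne : f ≠ P.Sstar.one (P.Sstar.src f)) :
    ∃ e', P.HasCohSquare Γ f g e e' := by
  rcases eq_one_or_eq_step_comp f with h | ⟨f₁, f₂, h₁, h₂, rfl⟩
  · exact absurd h hne
  rw [ExtCat.src_comp _ h₂] at hf
  rw [ExtCat.tgt_comp _ h₂] at nf
  have l₁ : length (P.Sstar.one (P.Etop.tgt e)) = 0 := length_one _
  -- The bottom branch is an identity, so the whole length one of the second side of the branching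
  -- is carried by `e`.
  obtain ⟨f', g', e₁, t₁, t₂, hL⟩ := hloc.exists_square (f := f₁)
    (g := P.Sstar.one (P.Etop.tgt e)) hf (ExtCat.src_one _) h₁ (by rw [l₁, he])
  rw [ExtCat.tgt_one] at t₂
  rw [ExtCat.one_comp_top _ t₂.symm] at hL
  obtain ⟨k, b, hk, nk, hb⟩ := exists_square_of_first_step hwf (hf ▸ ih) h₁ h₂ nf t₁ hL
  obtain ⟨c, hc⟩ := normalizes_of_eq_one hwf hloc ih' (f := P.Sstar.comp m g' k)
    (by rw [ExtCat.src_comp _ hk, t₂]) hg (by rwa [ExtCat.tgt_comp _ hk]) ng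
  exact ⟨_, hb.hcomp_one hc⟩

theorem normalizes_of_length_le_one (hwf : WellFounded fun v u => P.Step u v)
    (hloc : P.LocallyConfluent Γ) {e : P.Etop.Cell}
    (ih : ∀ z, TransGen P.Step (P.Etop.src e) z → P.NormalizesCoherently Γ z)
    (he : length e ≤ 1) {f g : P.Sstar.Cell} (hf : P.Sstar.src f = P.Etop.src e)
    (hg : P.Sstar.src g = P.Etop.tgt e) (nf : P.IsNormal (P.Sstar.tgt f))
    (ng : P.IsNormal (P.Sstar.tgt g)) : ∃ e', P.HasCohSquare Γ f g e e' := by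
  have of_length_eq_zero : ∀ (d : P.Etop.Cell), length d = 0 → d = P.Etop.one (P.Etop.src d) :=
    fun d hd => eq_one_of_length_eq_zero d hd
  have ih' : ∀ z, TransGen P.Step (P.Etop.tgt e) z → P.NormalizesCoherently Γ z :=
    fun z hz => ih z (transGen_step_of_equiv e hz)
  rcases Nat.le_one_iff_eq_zero_or_eq_one.1 he with he | he
  · have h := of_length_eq_zero e he
    have ht : P.Etop.tgt e = P.Etop.src e := by rw [h, ExtCat.tgt_one, ExtCat.src_one]
    rw [h]
    exact normalizes_of_eq_one hwf hloc ih hf (hg.trans ht) nf ng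
  by_cases hf₁ : f = P.Sstar.one (P.Sstar.src f)
  · by_cases hg₁ : g = P.Sstar.one (P.Sstar.src g)
    · rw [hf₁, hg₁, hf, hg]
      exact ⟨e, SquareExt.hasSquare_idv e⟩
    · obtain ⟨d, hd, ld⟩ := exists_isInverse e
      have ld : length d ≤ 1 := ld.trans_eq he
      -- A branching needs a step on top, so the roles of `f` and `g` are exchanged along the
      -- inverse `d` of `e`, and the square is inverted back for `⋄^h`.
      suffices ∃ e', P.HasCohSquare Γ g f d e' by
        obtain ⟨e', h⟩ := this
        obtain ⟨d', hd', -⟩ := exists_isInverse e'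
        exact ⟨d', h.inv hd.symm hd'⟩
      -- Only an upper bound on the length of the inverse is at hand, so length zero is treated
      -- separately by the identity case.
      rcases Nat.le_one_iff_eq_zero_or_eq_one.1 ld with ld | ld
      · have h := of_length_eq_zero d ld
        have ht : P.Etop.tgt d = P.Etop.src d := by rw [h, ExtCat.tgt_one, ExtCat.src_one]
        rw [h, hd.1]
        exact normalizes_of_eq_one hwf hloc ih' hg (by rw [hf, ← hd.2.1, ht, hd.1]) ng nf
      · exact normalizes_of_ne_one hwf hloc (hd.1.symm ▸ ih') (hd.2.1.symm ▸ ih) ld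
          (hg.trans hd.1.symm) (hf.trans hd.2.1.symm) ng nf hg₁
  · exact normalizes_of_ne_one hwf hloc ih ih' he hf hg nf ng hf₁

theorem normalizes_of_forall_lt (hwf : WellFounded fun v u => P.Step u v)
    (hloc : P.LocallyConfluent Γ) {x : P.base.Cell}
    (ih : ∀ z, TransGen P.Step x z → P.NormalizesCoherently Γ z) :
    P.NormalizesCoherently Γ x := by
  rintro e f g rfl hf hg nf ng
  have he : IsChain (Γ := P.modRules.add P.modRules.op)
    (X := InvRel (ι := P.modRules.Gen) _ Sum.inl Sum.inr) e := isChain e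
  -- The chain is peeled off from its source: the bottom `g` stays fixed, while the top becomes the
  -- chosen normalization of the next vertex.
  induction he generalizing f with
  | one x =>
    exact normalizes_of_eq_one hwf hloc ih hf hg nf ng
  | @cons e₁ e₂ h₁ h₂ _ ih₂ =>
    have h₂ : P.Etop.tgt e₁ = P.Etop.src e₂ := h₂
    have hs := P.Etop.src_comp h₂
    have hf : P.Sstar.src f = P.Etop.src e₁ := hf.trans hs
    have hg : P.Sstar.src g = P.Etop.tgt e₂ := hg.trans (P.Etop.tgt_comp h₂)
    have ih : ∀ z, TransGen P.Step (P.Etop.src e₁) z → P.NormalizesCoherently Γ z :=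
      fun z hz => ih z (hs.symm ▸ hz)
    -- Any normalization of the intermediate vertex will do, as the claim concerns all pairs of
    -- reductions to normal forms. It is the common side along which the two squares are stacked.
    obtain ⟨k, hk, nk⟩ := exists_isNormal hwf (P.Etop.tgt e₁)
    obtain ⟨a, ha⟩ := normalizes_of_length_le_one hwf hloc ih h₁ hf hk nf nk
    obtain ⟨b, hb⟩ := ih₂ k (fun z hz => ih z (transGen_step_of_equiv e₁ (h₂ ▸ hz)))
      (hk.trans h₂) hg nk
    exact ⟨_, ha.hcomp hb⟩

theorem normalizesCoherently (hwf : WellFounded fun v u => P.Step u v)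
    (hloc : P.LocallyConfluent Γ) (x : P.base.Cell) : P.NormalizesCoherently Γ x := by
  -- The transitive closure is needed because the hypothesis is applied at vertices several steps
  -- below `x`.
  have hwf' : WellFounded fun v u => TransGen P.Step u v :=
    Subrelation.wf (fun h => transGen_swap.2 h) hwf.transGen
  induction x using hwf'.induction with | _ x ih
  exact normalizes_of_forall_lt hwf hloc ih

end PolygraphModulo

end Polygr

/-- Coherent Newman's lemma modulo. -/
theorem theoremT {m : ℕ} (P : Polygr.PolygraphModulo.{u} m)
    (hterm : P.ERE.Terminating)
    (Γ : Polygr.SquareExt P.Etop P.Sstar)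
    (hloc : P.LocallyConfluent Γ) :
    P.Confluent Γ := by
  intro b
  have hwf : WellFounded fun v u => P.Step u v := hterm.wellFounded_modStep
  -- The completing cells are normalizations of the two targets, so the coherence claim applies
  -- directly to the prolonged branching.
  obtain ⟨f', hf, nf⟩ := P.exists_isNormal hwf (P.Sstar.tgt b.f)
  obtain ⟨g', hg, ng⟩ := P.exists_isNormal hwf (P.Sstar.tgt b.g)
  obtain ⟨e', hsq⟩ := P.normalizesCoherently hwf hloc (P.Etop.src b.e) b.e
    (P.Sstar.comp m b.f f') (P.Sstar.comp m b.g g') rfl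
    (by rw [Polygr.ExtCat.src_comp _ hf.symm, b.src_f])
    (by rw [Polygr.ExtCat.src_comp _ hg.symm, b.src_g])
    (by rwa [Polygr.ExtCat.tgt_comp _ hf.symm]) (by rwa [Polygr.ExtCat.tgt_comp _ hg.symm])
  have q := hsq.isSquare
  obtain ⟨A, hA⟩ := hsq
  exact ⟨f', g', e', A, hf.symm, hg.symm, by rw [q.src_vt, Polygr.ExtCat.tgt_comp _ hf.symm],
    by rw [q.tgt_vt, Polygr.ExtCat.tgt_comp _ hg.symm], hA⟩
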